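/- Let $\Gamma$ be a countable infinite connected (simple) graph with symmetric weights $\mu_{x,y}=\mu_{y,x}$, positive if $x\sim y$ and zero otherwise. Put $\mu(x)=\sum_{y}\mu_{x,y}$, which is assumed finite, $P(x,y)=\mu_{x,y}/\mu(x)$, $\Delta f(x)=\sum_y P(x,y)f(y)-f(x)$ and $(f,g)_\mu=\sum_x f(x)g(x)\mu(x)$. Let $d$ be the graph distance and $B(x,R)=\{y: d(x,y)<R\}$ for real $R$. For disjoint $A,B\subset\Gamma$ let $$\rho(A,B)=\Big(\inf\{(-\Delta f,f)_\mu : f \text{ finitely supported},\ f|_A=1,\ f|_B=0\}\Big)^{-1}\in[0,\infty],$$ and let $\rho(x,r,R)=\rho(B(x,r),\Gamma\setminus B(x,R))$ for $0\le r\le R$. Consider the conditions: - $(p_0)$: there is $p_0>0$ such that $\mu_{x,y}/\mu(x)\ge p_0$ for all $x\sim y$. - $(H)$ (elliptic Harnack inequality): there is $H>1$ such that for all $x\in\Gamma$, $R>0$ and every $u\ge 0$ defined on $B(x,2R)$ and the neighbours of its points, with $\sum_z P(y,z)u(z)=u(y)$ for all $y\in B(x,2R)$, one has $\max_{B(x,R)}u\le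 H\min_{B(x,R)}u$. - $(BC)$ (bounded covering): there is an integer $K$ such that for all $x\in\Gamma$, $R>0$ the ball $B(x,2R)$ can be covered by at most $K$ balls of radius $R$. Assume that $(\Gamma,\mu)$ satisfies $(p_0)$ and $(H)$. Then there is a constant $C_2>1$ such that for all $x\in\Gamma$ and all real $R\ge 0$ $$\rho(x,R,4R)\le C_2\,\rho(x,2R,4R).$$ If in addition $(BC)$ holds, then there is a constant $C_1>1$ such that for all $x\in\Gamma$ and all real $R\ge 0$ $$\rho(x,R,4R)\le C_1\,\rho(x,R,2R).$$ -/

import Mathlib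

open scoped ENNReal NNReal

/-- A connected graph with symmetric weights `w x y = w y x`, positive exactly on the edges, such
that every vertex has finite total weight (so that the random walk on the graph is defined). -/
structure WeightedGraph (V : Type*) where
  graph : SimpleGraph V
  connected : graph.Connected
  w : V → V → ℝ
  w_symm : ∀ x y, w x y = w y x
  w_pos : ∀ x y, graph.Adj x y → 0 < w x y
  w_zero : ∀ x y, ¬ graph.Adj x y → w x y = 0
  w_summable : ∀ x, Summable (w x)

namespace WeightedGraph

variable {V : Type*} (Γ : WeightedGraph V)

/-- The measure of a vertex, `μ(x) = ∑_{y ∼ x} μ_{x,y}`. -/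
noncomputable def mu (x : V) : ℝ := ∑' y, Γ.w x y

/-- The transition probabilities `P(x,y) = μ_{x,y} / μ(x)`. -/
noncomputable def P (x y : V) : ℝ := Γ.w x y / Γ.mu x

/-- The Markov operator `Pf(x) = ∑_y P(x,y) f(y)`. -/
noncomputable def markov (f : V → ℝ) (x : V) : ℝ := ∑' y, Γ.P x y * f y

/-- The Laplace operator `Δ = P - I`. -/
noncomputable def laplace (f : V → ℝ) (x : V) : ℝ := Γ.markov f x - f x

/-- The inner product `(f,g)_μ = ∑_x f(x) g(x) μ(x)`; only used when one factor is finitely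
supported. -/
noncomputable def innerMu (f g : V → ℝ) : ℝ := ∑' x, f x * g x * Γ.mu x

/-- The open ball of real radius `R` for the shortest path distance. -/
def ball (x : V) (R : ℝ) : Set V := {y | (Γ.graph.dist x y : ℝ) < R}

/-- The set `A` together with all neighbours of its points. -/
def closure (A : Set V) : Set V := A ∪ {y | ∃ x ∈ A, Γ.graph.Adj x y}

/-- The resistance between two (disjoint) sets: the reciprocal of the infimum of `(-Δf, f)_μ` over
the finitely supported `f` with `f = 1` on `A` and `f = 0` on `B`, with `1/0 = ∞`. -/
noncomputable def resistance (A B : Set V) : ℝ≥0∞ :=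
  (⨅ f ∈ {f : V →₀ ℝ | (∀ a ∈ A, f a = 1) ∧ ∀ b ∈ B, f b = 0},
    ENNReal.ofReal (Γ.innerMu (fun x => - Γ.laplace f x) f))⁻¹

/-- The resistance of the annulus, `ρ(x,r,R) = ρ(B(x,r), Γ \ B(x,R))`. -/
noncomputable def rho (x : V) (r R : ℝ) : ℝ≥0∞ :=
  Γ.resistance (Γ.ball x r) (Γ.ball x R)ᶜ

/-- Condition (p₀), controlled weights. -/
def P0 : Prop := ∃ p₀ : ℝ, 0 < p₀ ∧ ∀ x y, Γ.graph.Adj x y → p₀ ≤ Γ.w x y / Γ.mu x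

/-- `h` is harmonic on `A`. Only the values of `h` on the closure of `A` matter. -/
def HarmonicOn (h : V → ℝ) (A : Set V) : Prop := ∀ x ∈ A, Γ.markov h x = h x

/-- The elliptic Harnack inequality: `max_{B(x,R)} u ≤ H min_{B(x,R)} u` whenever `u` is
non-negative (on the closure of `B(x,2R)`, its domain) and harmonic in `B(x,2R)`. -/
def Harnack : Prop :=
  ∃ H : ℝ, 1 < H ∧ ∀ (x : V) (R : ℝ), 0 < R → ∀ u : V → ℝ,
    (∀ y ∈ Γ.closure (Γ.ball x (2 * R)), 0 ≤ u y) → Γ.HarmonicOn u (Γ.ball x (2 * R)) →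
      ∀ y ∈ Γ.ball x R, ∀ z ∈ Γ.ball x R, u y ≤ H * u z

/-- The bounded covering condition: every ball `B(x,2R)` is covered by at most `K` balls of
radius `R`. -/
def BoundedCovering : Prop :=
  ∃ K : ℕ, ∀ (x : V) (R : ℝ), 0 < R →
    ∃ s : Finset V, s.card ≤ K ∧ Γ.ball x (2 * R) ⊆ ⋃ c ∈ s, Γ.ball c R

end WeightedGraph

/-!
The equilibrium potential of `A` in a finite set `D`, normalised to unit charge, is constant on `A`
with value the resistance between `A` and the complement of `D`, and it is an average of the Green
function of `D` over the inner boundary of `A`.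

So `ρ(x, R, 4R)` and `ρ(x, 2R, 4R)` are averages of the Green function of `B(x, 4R)` with pole `x`
over points at distance about `R` and about `2R`. The Green function at such points is compared by
Harnack chains along geodesics; if the geodesic comes close to the pole, the symmetry of the Green
function allows one to move the pole instead.

For the second inequality, take two balls of radius `R / 16` with centres in `B(x, 3R)` at distance
at least `R / 2`. If each of their equilibrium potentials in `B(x, 10R)` came within `δ` of its
maximum somewhere on the other ball, Harnack chains would spread this over `B(x, 5R)` and give
`ρ(x, R, 4R) ≤ C δ`. Hence one of the two potentials, truncated, provides a cut-off function between
the two balls of energy at most `C / ρ(x, R, 4R)`. Minima and maxima over the boundedly many pairs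
of balls in a covering then give a cut-off function for `B(x, R)` in `B(x, 2R)`.

This needs `R` to be large; for small `R`, condition `(p₀)` makes all the resistances comparable to
`1 / μ(x)`.
-/

namespace WeightedGraph

variable {V : Type*} {Γ : WeightedGraph V}

/-! ### Graph distance, balls and geodesic segments -/

section Distance

/-- The graph distance, as a real number so that it can be compared with the radii of balls. -/
noncomputable def dist (Γ : WeightedGraph V) (x y : V) : ℝ := Γ.graph.dist x y

lemma dist_nonneg (Γ : WeightedGraph V) (x y : V) : 0 ≤ Γ.dist x y := Nat.cast_nonneg _

lemma dist_self (Γ : WeightedGraph V) (x : V) : Γ.dist x x = 0 := by simp [dist]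

lemma dist_comm (Γ : WeightedGraph V) (x y : V) : Γ.dist x y = Γ.dist y x := by
  simp [dist, SimpleGraph.dist_comm]

lemma dist_triangle (Γ : WeightedGraph V) (x y z : V) : Γ.dist x z ≤ Γ.dist x y + Γ.dist y z := by
  unfold dist; exact_mod_cast Γ.connected.dist_triangle

lemma eq_of_dist_lt_one {x y : V} (h : Γ.dist x y < 1) : x = y :=
  Γ.connected.dist_eq_zero_iff.1 (Nat.cast_lt_one.1 h)

lemma dist_eq_one_of_adj {x y : V} (h : Γ.graph.Adj x y) : Γ.dist x y = 1 := by
  unfold dist; exact_mod_cast SimpleGraph.dist_eq_one_iff_adj.2 h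

lemma dist_le_add_one_of_adj (Γ : WeightedGraph V) (x : V) {y z : V} (h : Γ.graph.Adj y z) :
    Γ.dist x z ≤ Γ.dist x y + 1 :=
  (Γ.dist_triangle x y z).trans_eq (by rw [dist_eq_one_of_adj h])

lemma mem_ball {x y : V} {R : ℝ} : y ∈ Γ.ball x R ↔ Γ.dist x y < R := Iff.rfl

lemma mem_ball_self (x : V) {R : ℝ} (hR : 0 < R) : x ∈ Γ.ball x R :=
  mem_ball.2 (by rwa [dist_self])

lemma ball_subset_ball (x : V) {r R : ℝ} (h : r ≤ R) : Γ.ball x r ⊆ Γ.ball x R :=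
  fun _ hy => (mem_ball.1 hy).trans_le h

lemma ball_subset_ball_of_dist_add_le {x y : V} {r R : ℝ} (h : Γ.dist x y + r ≤ R) :
    Γ.ball y r ⊆ Γ.ball x R := fun z hz =>
  mem_ball.2 (by linarith [mem_ball.1 hz, Γ.dist_triangle x y z])

lemma dist_lt_of_mem_closure_ball {x y : V} {R : ℝ} (h : y ∈ Γ.closure (Γ.ball x R)) :
    Γ.dist x y < R + 1 := by
  rcases h with h | ⟨z, hz, hzy⟩
  · linarith [mem_ball.1 h]
  · linarith [mem_ball.1 hz, Γ.dist_le_add_one_of_adj x hzy]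

lemma subset_closure (A : Set V) : A ⊆ Γ.closure A := Set.subset_union_left

lemma mem_closure_of_adj {A : Set V} {x y : V} (hx : x ∈ A) (h : Γ.graph.Adj x y) :
    y ∈ Γ.closure A := Or.inr ⟨x, hx, h⟩

lemma closure_mono {A B : Set V} (h : A ⊆ B) : Γ.closure A ⊆ Γ.closure B :=
  Set.union_subset_union h fun _ ⟨x, hx, hxy⟩ => ⟨x, h hx, hxy⟩

/-- The geodesic segment: the vertices on some shortest path from `p` to `q`. -/
def segment (Γ : WeightedGraph V) (p q : V) : Set V :=
  {z | Γ.dist p z + Γ.dist z q = Γ.dist p q}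

lemma left_mem_segment (p q : V) : p ∈ Γ.segment p q := show _ + _ = _ by
  rw [dist_self, zero_add]

lemma right_mem_segment (p q : V) : q ∈ Γ.segment p q := show _ + _ = _ by
  rw [dist_self, add_zero]

lemma segment_comm (p q : V) : Γ.segment p q = Γ.segment q p := by
  ext z
  simp only [segment, Set.mem_ofPred_eq, Γ.dist_comm _ z, Γ.dist_comm p q, add_comm]

lemma segment_subset_segment {p q z : V} (hz : z ∈ Γ.segment p q) :
    Γ.segment z q ⊆ Γ.segment p q := fun w hw => show _ = _ by
  have hz : Γ.dist p z + Γ.dist z q = Γ.dist p q := hz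
  have hw : Γ.dist z w + Γ.dist w q = Γ.dist z q := hw
  linarith [Γ.dist_triangle p z w, Γ.dist_triangle p w q]

lemma exists_mem_segment_dist_eq {x y : V} {k : ℕ} (hk : (k : ℝ) ≤ Γ.dist x y) :
    ∃ z ∈ Γ.segment x y, Γ.dist x z = k := by
  obtain ⟨p, hp⟩ := Γ.connected.exists_walk_length_eq_dist x y
  have hkp : k ≤ p.length := by rw [hp]; exact Nat.cast_le.1 hk
  have htake : Γ.dist x (p.getVert k) ≤ k :=
    Nat.cast_le.2 <| (SimpleGraph.dist_le (p.take k)).trans (by simp)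
  have hdrop : Γ.dist (p.getVert k) y ≤ Γ.dist x y - k := by
    have := Nat.cast_le (α := ℝ).2 (SimpleGraph.dist_le (p.drop k))
    rwa [SimpleGraph.Walk.drop_length, Nat.cast_sub hkp, hp] at this
  have htri := Γ.dist_triangle x (p.getVert k) y
  exact ⟨p.getVert k, show _ + _ = _ by linarith, by linarith⟩

lemma ball_subset_of_mem_segment {x p q z : V} {s L : ℝ} (hz : z ∈ Γ.segment p q)
    (h : Γ.dist x p + Γ.dist x q + s ≤ L) : Γ.ball z s ⊆ Γ.ball x L := by
  have hz : Γ.dist p z + Γ.dist z q = Γ.dist p q := hz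
  apply ball_subset_ball_of_dist_add_le
  linarith [Γ.dist_triangle x p z, Γ.dist_triangle x q z, Γ.dist_triangle p x q,
    Γ.dist_comm p x, Γ.dist_comm q z]

/-- Going to `p` from far points `a` and `b`, a geodesic cannot come close to the other far point
in both cases. -/
lemma segment_avoids_or_segment_avoids {a b : V} {s : ℝ} (h : 2 * s ≤ Γ.dist a b) (p : V) :
    (∀ z ∈ Γ.segment p b, s ≤ Γ.dist a z) ∨ ∀ z ∈ Γ.segment p a, s ≤ Γ.dist b z := by
  by_contra! hn
  obtain ⟨⟨y, hy, hay⟩, z, hz, hbz⟩ := hn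
  have hy : Γ.dist p y + Γ.dist y b = Γ.dist p b := hy
  have hz : Γ.dist p z + Γ.dist z a = Γ.dist p a := hz
  linarith [Γ.dist_triangle p y a, Γ.dist_triangle p z b, Γ.dist_triangle a y b,
    Γ.dist_triangle a z b, Γ.dist_comm a y, Γ.dist_comm b z, Γ.dist_comm a z]

lemma ball_add_one_subset_closure_ball (x : V) {R : ℝ} (hR : 0 < R) :
    Γ.ball x (R + 1) ⊆ Γ.closure (Γ.ball x R) := by
  intro y hy
  have hy : Γ.dist x y < R + 1 := hy
  rcases eq_or_ne x y with rfl | hxy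
  · exact subset_closure _ (mem_ball_self x hR)
  obtain ⟨k, hk⟩ := Nat.exists_eq_succ_of_ne_zero (Γ.connected.pos_dist_of_ne hxy).ne'
  have hdist : Γ.dist x y = k + 1 := by rw [dist, hk]; push_cast; rfl
  obtain ⟨z, hz, hxz⟩ := exists_mem_segment_dist_eq (Γ := Γ) (x := x) (y := y) (k := k)
    (by linarith)
  have hzy : Γ.dist z y = 1 := by have : _ + _ = _ := hz; linarith
  exact mem_closure_of_adj (mem_ball.2 (by linarith))
    (SimpleGraph.dist_eq_one_iff_adj.1 (by unfold dist at hzy; exact_mod_cast hzy))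

lemma closure_diff_nonempty [Infinite V] {W : Set V} (hW : W.Finite) (hne : W.Nonempty) :
    (Γ.closure W \ W).Nonempty := by
  obtain ⟨x, hx⟩ := hne
  obtain ⟨y, hy⟩ := hW.infinite_compl.nonempty
  obtain ⟨p⟩ := Γ.connected.preconnected x y
  obtain ⟨a, -, ha, hb⟩ := p.exists_boundary_dart W hx hy
  exact ⟨a.snd, mem_closure_of_adj ha a.adj, hb⟩

end Distance

section LocallyFinite

variable [Γ.graph.LocallyFinite]

lemma finite_closure {A : Set V} (hA : A.Finite) : (Γ.closure A).Finite := by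
  refine hA.union ((hA.biUnion fun x _ => (Γ.graph.neighborSet x).toFinite).subset ?_)
  rintro y ⟨x, hx, hxy⟩
  exact Set.mem_biUnion hx hxy

lemma finite_ball (x : V) (R : ℝ) : (Γ.ball x R).Finite := by
  have hnat (n : ℕ) : (Γ.ball x (n + 1)).Finite := by
    induction n with
    | zero =>
      exact (Set.finite_singleton x).subset fun y hy =>
        (eq_of_dist_lt_one (by simpa [mem_ball] using hy)).symm
    | succ n ih =>
      have := (finite_closure ih).subset (ball_add_one_subset_closure_ball x (by positivity))
      exact_mod_cast this
  exact (hnat ⌈R⌉₊).subset (ball_subset_ball x (by linarith [Nat.le_ceil R]))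

/-- The ball as a `Finset`, over which one can sum. -/
noncomputable def ballFinset (Γ : WeightedGraph V) [Γ.graph.LocallyFinite] (x : V) (R : ℝ) :
    Finset V := (finite_ball (Γ := Γ) x R).toFinset

lemma coe_ballFinset (x : V) (R : ℝ) : (Γ.ballFinset x R : Set V) = Γ.ball x R :=
  Set.Finite.coe_toFinset _

lemma mem_ballFinset {x y : V} {R : ℝ} : y ∈ Γ.ballFinset x R ↔ Γ.dist x y < R :=
  Set.Finite.mem_toFinset _

lemma exists_finset_closure_subset (D : Finset V) : ∃ F : Finset V, Γ.closure D ⊆ F :=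
  ⟨(finite_closure D.finite_toSet).toFinset, (Set.Finite.coe_toFinset _).ge⟩

end LocallyFinite

/-! ### The Laplacian and the Dirichlet form -/

section Laplacian

lemma w_nonneg (x y : V) : 0 ≤ Γ.w x y := by
  by_cases h : Γ.graph.Adj x y
  · exact (Γ.w_pos x y h).le
  · exact (Γ.w_zero x y h).ge

lemma w_le_mu (x y : V) : Γ.w x y ≤ Γ.mu x :=
  (Γ.w_summable x).le_tsum y fun z _ => w_nonneg x z

lemma mu_pos [Nontrivial V] (x : V) : 0 < Γ.mu x := by
  obtain ⟨y, hy⟩ := Γ.connected.preconnected.exists_adj_of_nontrivial x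
  exact (Γ.w_pos x y hy).trans_le (w_le_mu x y)

/-- The operator `-μΔ`, whose matrix is symmetric; unlike `Δ` it involves no division. -/
noncomputable def lap (Γ : WeightedGraph V) (f : V → ℝ) (x : V) : ℝ :=
  ∑' y, Γ.w x y * (f x - f y)

lemma lap_nonneg_of_forall_le {f : V → ℝ} {x : V} (h : ∀ y, f y ≤ f x) : 0 ≤ Γ.lap f x :=
  tsum_nonneg fun y => mul_nonneg (w_nonneg x y) (sub_nonneg.2 (h y))

lemma lap_eq_zero_of_forall_adj {f : V → ℝ} {x : V} (h : ∀ y, Γ.graph.Adj x y → f y = f x) :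
    Γ.lap f x = 0 := by
  refine (tsum_congr fun y => ?_).trans tsum_zero
  by_cases hxy : Γ.graph.Adj x y
  · rw [h y hxy, sub_self, mul_zero]
  · rw [Γ.w_zero x y hxy, zero_mul]

lemma lap_sub_const (f : V → ℝ) (c : ℝ) (x : V) : Γ.lap (fun y => f y - c) x = Γ.lap f x := by
  simp [lap]

lemma tsum_w_mul_eq_sum {F : Finset V} {x : V} (hF : ∀ y, Γ.graph.Adj x y → y ∈ F) (h : V → ℝ) :
    ∑' y, Γ.w x y * h y = ∑ y ∈ F, Γ.w x y * h y :=
  tsum_eq_sum fun y hy => by rw [Γ.w_zero x y fun h => hy (hF y h), zero_mul]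

variable [Γ.graph.LocallyFinite]

lemma lap_eq_sum (f : V → ℝ) (x : V) :
    Γ.lap f x = ∑ y ∈ Γ.graph.neighborFinset x, Γ.w x y * (f x - f y) :=
  tsum_w_mul_eq_sum (by simp) fun y => f x - f y

lemma lap_add (f g : V → ℝ) (x : V) :
    Γ.lap (fun y => f y + g y) x = Γ.lap f x + Γ.lap g x := by
  simp only [lap_eq_sum, ← Finset.sum_add_distrib]
  exact Finset.sum_congr rfl fun y _ => by ring

lemma lap_const_mul (c : ℝ) (f : V → ℝ) (x : V) :
    Γ.lap (fun y => c * f y) x = c * Γ.lap f x := by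
  simp only [lap_eq_sum, Finset.mul_sum]
  exact Finset.sum_congr rfl fun y _ => by ring

lemma lap_sub (f g : V → ℝ) (x : V) :
    Γ.lap (fun y => f y - g y) x = Γ.lap f x - Γ.lap g x := by
  simp only [lap_eq_sum, ← Finset.sum_sub_distrib]
  exact Finset.sum_congr rfl fun y _ => by ring

lemma lap_const_sub (c : ℝ) (f : V → ℝ) (x : V) :
    Γ.lap (fun y => c - f y) x = -Γ.lap f x := by
  rw [lap_sub (fun _ => c), lap_eq_zero_of_forall_adj fun _ _ => rfl, zero_sub]

lemma lap_eq [Nontrivial V] (f : V → ℝ) (x : V) : Γ.lap f x = Γ.mu x * -Γ.laplace f x := by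
  have hμ : Γ.mu x ≠ 0 := (mu_pos x).ne'
  have hmarkov : Γ.mu x * Γ.markov f x = ∑' y, Γ.w x y * f y := by
    rw [markov, ← tsum_mul_left]
    exact tsum_congr fun y => by rw [P]; field_simp
  have hmu : Γ.mu x = ∑ y ∈ Γ.graph.neighborFinset x, Γ.w x y := by
    simpa [mu] using tsum_w_mul_eq_sum (Γ := Γ) (x := x) (by simp) fun _ => 1
  rw [laplace, neg_sub, mul_sub, hmarkov, tsum_w_mul_eq_sum (F := Γ.graph.neighborFinset x)
    (by simp), lap_eq_sum, hmu, Finset.sum_mul, ← Finset.sum_sub_distrib]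
  exact Finset.sum_congr rfl fun y _ => mul_sub _ _ _

lemma harmonicOn_iff_lap_eq_zero [Nontrivial V] {u : V → ℝ} {A : Set V} :
    Γ.HarmonicOn u A ↔ ∀ x ∈ A, Γ.lap u x = 0 := by
  refine forall₂_congr fun x _ => ?_
  rw [lap_eq, laplace, mul_eq_zero, or_iff_right (mu_pos x).ne', neg_eq_zero, sub_eq_zero]

end Laplacian

section DirichletForm

/-- The Dirichlet form of the network induced on the finite set `F`. For functions vanishing off
`D` it does not depend on the choice of `F ⊇ closure D`. -/
noncomputable def form (Γ : WeightedGraph V) (F : Finset V) (f g : V → ℝ) : ℝ :=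
  (∑ x ∈ F, ∑ y ∈ F, Γ.w x y * ((f x - f y) * (g x - g y))) / 2

lemma form_comm (F : Finset V) (f g : V → ℝ) : Γ.form F f g = Γ.form F g f := by
  simp only [form, mul_comm]

lemma form_const_mul_self (F : Finset V) (c : ℝ) (f : V → ℝ) :
    Γ.form F (fun x => c * f x) (fun x => c * f x) = c ^ 2 * Γ.form F f f := by
  simp only [form, ← mul_sub, mul_div_assoc', Finset.mul_sum]
  congr 1
  exact Finset.sum_congr rfl fun x _ => Finset.sum_congr rfl fun y _ => by ring

lemma form_cauchy_schwarz (F : Finset V) (f g : V → ℝ) :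
    Γ.form F f g ^ 2 ≤ Γ.form F f f * Γ.form F g g := by
  have := Finset.sum_sq_le_sum_mul_sum_of_sq_le_mul (F ×ˢ F)
    (r := fun p => Γ.w p.1 p.2 * ((f p.1 - f p.2) * (g p.1 - g p.2)))
    (f := fun p => Γ.w p.1 p.2 * ((f p.1 - f p.2) * (f p.1 - f p.2)))
    (g := fun p => Γ.w p.1 p.2 * ((g p.1 - g p.2) * (g p.1 - g p.2)))
    (fun p _ => mul_nonneg (w_nonneg _ _) (mul_self_nonneg _))
    (fun p _ => mul_nonneg (w_nonneg _ _) (mul_self_nonneg _)) fun p _ => le_of_eq (by ring)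
  simp only [form, ← Finset.sum_product']
  linarith

lemma w_mul_sq_le_two_mul_form {F : Finset V} {x y : V} (hx : x ∈ F) (hy : y ∈ F) (f : V → ℝ) :
    Γ.w x y * (f x - f y) ^ 2 ≤ 2 * Γ.form F f f := by
  have hterm (x y : V) : 0 ≤ Γ.w x y * ((f x - f y) * (f x - f y)) :=
    mul_nonneg (w_nonneg x y) (mul_self_nonneg _)
  calc Γ.w x y * (f x - f y) ^ 2 = Γ.w x y * ((f x - f y) * (f x - f y)) := by rw [sq]
    _ ≤ ∑ z ∈ F, Γ.w x z * ((f x - f z) * (f x - f z)) :=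
      Finset.single_le_sum (fun z _ => hterm x z) hy
    _ ≤ ∑ t ∈ F, ∑ z ∈ F, Γ.w t z * ((f t - f z) * (f t - f z)) :=
      Finset.single_le_sum (f := fun t => ∑ z ∈ F, Γ.w t z * ((f t - f z) * (f t - f z)))
        (fun t _ => Finset.sum_nonneg fun z _ => hterm t z) hx
    _ = 2 * Γ.form F f f := by rw [form]; ring

lemma form_eq_sum (F : Finset V) (f g : V → ℝ) :
    Γ.form F f g = ∑ x ∈ F, f x * ∑ y ∈ F, Γ.w x y * (g x - g y) := by
  have hanti : ∑ x ∈ F, ∑ y ∈ F, f y * (Γ.w x y * (g x - g y)) =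
      -∑ x ∈ F, ∑ y ∈ F, f x * (Γ.w x y * (g x - g y)) := by
    rw [Finset.sum_comm]
    simp only [← Finset.sum_neg_distrib]
    exact Finset.sum_congr rfl fun x _ => Finset.sum_congr rfl fun y _ => by
      rw [Γ.w_symm y x]; ring
  have hsplit : ∑ x ∈ F, ∑ y ∈ F, Γ.w x y * ((f x - f y) * (g x - g y)) =
      ∑ x ∈ F, ∑ y ∈ F, f x * (Γ.w x y * (g x - g y)) -
        ∑ x ∈ F, ∑ y ∈ F, f y * (Γ.w x y * (g x - g y)) := by
    simp only [← Finset.sum_sub_distrib]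
    exact Finset.sum_congr rfl fun x _ => Finset.sum_congr rfl fun y _ => by ring
  simp only [form, hsplit, hanti, Finset.mul_sum]
  ring

variable {D F : Finset V}

lemma form_eq_sum_mul_lap (hF : Γ.closure D ⊆ F) {f : V → ℝ} (hf : ∀ x ∉ D, f x = 0)
    (g : V → ℝ) : Γ.form F f g = ∑ x ∈ D, f x * Γ.lap g x := by
  have hDF : D ⊆ F := fun x hx => hF (subset_closure _ hx)
  rw [form_eq_sum, ← Finset.sum_subset hDF fun x _ hx => by rw [hf x hx, zero_mul]]
  exact Finset.sum_congr rfl fun x hx => by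
    rw [lap, tsum_w_mul_eq_sum (fun y hy => hF (mem_closure_of_adj hx hy)) fun y => g x - g y]

variable [Γ.graph.LocallyFinite]

lemma sum_mul_lap_comm {f g : V → ℝ} (hf : ∀ x ∉ D, f x = 0) (hg : ∀ x ∉ D, g x = 0) :
    ∑ x ∈ D, f x * Γ.lap g x = ∑ x ∈ D, g x * Γ.lap f x := by
  obtain ⟨F, hF⟩ := exists_finset_closure_subset (Γ := Γ) D
  rw [← form_eq_sum_mul_lap hF hf, ← form_eq_sum_mul_lap hF hg, form_comm]

lemma innerMu_eq_form [Nontrivial V] (hF : Γ.closure D ⊆ F) {f : V → ℝ}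
    (hf : ∀ x ∉ D, f x = 0) : Γ.innerMu (fun x => -Γ.laplace f x) f = Γ.form F f f := by
  rw [form_eq_sum_mul_lap hF hf, innerMu, tsum_eq_sum fun x hx => by rw [hf x hx]; ring]
  exact Finset.sum_congr rfl fun x _ => by rw [lap_eq]; ring

end DirichletForm

/-! ### The minimum principle and the Dirichlet problem -/

section MinimumPrinciple

variable [Γ.graph.LocallyFinite]

lemma eq_of_adj_of_lap_nonneg {u : V → ℝ} {x y : V} (hu : 0 ≤ Γ.lap u x)
    (hmin : ∀ z, Γ.graph.Adj x z → u x ≤ u z) (hxy : Γ.graph.Adj x y) : u y = u x := by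
  rw [lap_eq_sum] at hu
  have hterm : ∀ z ∈ Γ.graph.neighborFinset x, Γ.w x z * (u x - u z) ≤ 0 := fun z hz =>
    mul_nonpos_of_nonneg_of_nonpos (w_nonneg x z) (sub_nonpos.2 (hmin z (by simpa using hz)))
  have hzero := (Finset.sum_eq_zero_iff_of_nonpos hterm).1
    (le_antisymm (Finset.sum_nonpos hterm) hu) y (by simpa using hxy)
  have := (mul_eq_zero.1 hzero).resolve_left (Γ.w_pos x y hxy).ne'
  linarith

variable [Infinite V] {W : Set V} {u : V → ℝ} {c : ℝ}

lemma le_on_closure_of_le_on_boundary (hW : W.Finite) (hu : ∀ x ∈ W, 0 ≤ Γ.lap u x)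
    (hb : ∀ y ∈ Γ.closure W \ W, c ≤ u y) : ∀ x ∈ Γ.closure W, c ≤ u x := by
  intro x hx
  by_cases hxW : x ∈ W
  swap
  · exact hb x ⟨hx, hxW⟩
  obtain ⟨p, hp, hmin⟩ := W.exists_min_image u hW ⟨x, hxW⟩
  refine le_trans ?_ (hmin x hxW)
  by_contra! hpc
  have hlevel : ({z ∈ W | u z = u p} : Set V).Finite := hW.subset (Set.sep_subset _ _)
  obtain ⟨q, hq⟩ := hlevel.infinite_compl.nonempty
  obtain ⟨walk⟩ := Γ.connected.preconnected p q
  obtain ⟨a, -, ⟨haW, hap⟩, ha⟩ := walk.exists_boundary_dart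
    ({z ∈ W | u z = u p} : Set V) ⟨hp, rfl⟩ hq
  have hle (z : V) (hz : Γ.graph.Adj a.fst z) : u a.fst ≤ u z := by
    by_cases hzW : z ∈ W
    · exact hap.trans_le (hmin z hzW)
    · exact hap.trans_le (hpc.le.trans (hb z ⟨mem_closure_of_adj haW hz, hzW⟩))
  have heq : u a.snd = u p := (eq_of_adj_of_lap_nonneg (hu _ haW) hle a.adj).trans hap
  refine ha ⟨by_contra fun hW' => ?_, heq⟩
  exact (hb a.snd ⟨mem_closure_of_adj haW a.adj, hW'⟩).not_gt (heq.trans_lt hpc)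

lemma le_of_le_off (hW : W.Finite) (hu : ∀ x ∈ W, 0 ≤ Γ.lap u x) (hb : ∀ y ∉ W, c ≤ u y)
    (x : V) : c ≤ u x := by
  by_cases hx : x ∈ W
  · exact le_on_closure_of_le_on_boundary hW hu (fun y hy => hb y hy.2) x (subset_closure W hx)
  · exact hb x hx

lemma eq_zero_of_lap_eq_zero (hW : W.Finite) (hu : ∀ x ∈ W, Γ.lap u x = 0)
    (hb : ∀ y ∉ W, u y = 0) (x : V) : u x = 0 := by
  have hneg := le_of_le_off (Γ := Γ) (u := fun y => 0 - u y) hW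
    (fun y hy => by rw [lap_const_sub, hu y hy, neg_zero]) (fun y hy => by rw [hb y hy, sub_self]) x
  have hpos := le_of_le_off hW (fun y hy => (hu y hy).ge) (fun y hy => (hb y hy).ge) x
  linarith

/-- The Laplacian restricted to `W` is injective by the minimum principle, hence surjective. -/
lemma exists_lap_eq_of_eq_zero_off (hW : W.Finite) (ψ : V → ℝ) :
    ∃ u : V → ℝ, (∀ x ∉ W, u x = 0) ∧ ∀ x ∈ W, Γ.lap u x = ψ x := by
  have : Fintype W := hW.fintype
  let ext : (W → ℝ) →ₗ[ℝ] V → ℝ := Function.ExtendByZero.linearMap ℝ ((↑) : W → V)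
  have ext_off (v : W → ℝ) (x : V) (hx : x ∉ W) : ext v x = 0 :=
    Function.extend_apply' _ _ _ fun ⟨y, hy⟩ => hx (hy ▸ y.2)
  have ext_on (v : W → ℝ) (x : W) : ext v x = v x := Subtype.val_injective.extend_apply _ _ x
  let T : (W → ℝ) →ₗ[ℝ] W → ℝ :=
    { toFun := fun v x => Γ.lap (ext v) x
      map_add' := fun v v' => by rw [map_add]; exact funext fun x => lap_add _ _ _
      map_smul' := fun c v => by rw [map_smul]; exact funext fun x => lap_const_mul _ _ _ }
  have hinj : Function.Injective T := by
    refine (injective_iff_map_eq_zero T).2 fun v hv => funext fun x => ?_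
    rw [← ext_on v x]
    exact eq_zero_of_lap_eq_zero hW (fun y hy => congrFun hv ⟨y, hy⟩) (ext_off v) x
  obtain ⟨v, hv⟩ := LinearMap.injective_iff_surjective.1 hinj fun x => ψ x
  exact ⟨ext v, ext_off v, fun x hx => congrFun hv ⟨x, hx⟩⟩

lemma exists_harmonic_extension (hW : W.Finite) (φ : V → ℝ) :
    ∃ u : V → ℝ, (∀ x ∉ W, u x = φ x) ∧ ∀ x ∈ W, Γ.lap u x = 0 := by
  obtain ⟨v, hv, hlap⟩ := exists_lap_eq_of_eq_zero_off (Γ := Γ) hW fun x => -Γ.lap φ x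
  exact ⟨fun x => v x + φ x, fun x hx => by simp only [hv x hx, zero_add],
    fun x hx => by rw [lap_add, hlap x hx, neg_add_cancel]⟩

end MinimumPrinciple

/-! ### Equilibrium potentials -/

section Equilibrium

/-- The vertices of `A` that have a neighbour outside `A`. They carry all the charge of an
equilibrium potential of `A`. -/
def innerBoundary (Γ : WeightedGraph V) (A : Set V) : Set V :=
  {x ∈ A | ∃ y ∉ A, Γ.graph.Adj x y}

lemma innerBoundary_subset (A : Set V) : Γ.innerBoundary A ⊆ A := Set.sep_subset _ _

lemma sub_one_le_dist_of_mem_innerBoundary_ball {x y : V} {R : ℝ}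
    (h : y ∈ Γ.innerBoundary (Γ.ball x R)) : R - 1 ≤ Γ.dist x y := by
  obtain ⟨-, z, hz, hyz⟩ := h
  linarith [not_lt.1 (mt mem_ball.2 hz), Γ.dist_le_add_one_of_adj x hyz]

/-- `e` is the equilibrium potential of `A` in `D`: the function harmonic in `D \ A`, vanishing off
`D` and constant on `A`, normalised to have total charge `1` instead of the value `1` on `A`. Its
value `M` on `A` is then the resistance between `A` and the complement of `D`. -/
structure IsEquilibrium (Γ : WeightedGraph V) (D : Finset V) (A : Set V) (e : V → ℝ) (M : ℝ) :
    Prop where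
  subset : A ⊆ D
  eq : ∀ x ∈ A, e x = M
  nonneg : ∀ x, 0 ≤ e x
  le : ∀ x, e x ≤ M
  zero : ∀ x ∉ D, e x = 0
  lap_zero : ∀ x ∈ D, x ∉ A → Γ.lap e x = 0
  charge : ∑ x ∈ D, Γ.lap e x = 1

namespace IsEquilibrium

variable {D : Finset V} {A A' : Set V} {e e' f : V → ℝ} {M M' c : ℝ}

lemma lap_nonneg (he : Γ.IsEquilibrium D A e M) {x : V} (hx : x ∈ D) : 0 ≤ Γ.lap e x := by
  by_cases h : x ∈ A
  · exact lap_nonneg_of_forall_le fun y => (he.le y).trans_eq (he.eq x h).symm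
  · exact (he.lap_zero x hx h).ge

lemma mem_innerBoundary_of_lap_ne_zero (he : Γ.IsEquilibrium D A e M) {x : V} (hx : x ∈ D)
    (h : Γ.lap e x ≠ 0) : x ∈ Γ.innerBoundary A := by
  have hA : x ∈ A := by_contra fun hA => h (he.lap_zero x hx hA)
  refine ⟨hA, by_contra fun hnot => h (lap_eq_zero_of_forall_adj fun y hxy => ?_)⟩
  have hy : y ∈ A := by_contra fun hy => hnot ⟨y, hy, hxy⟩
  rw [he.eq x hA, he.eq y hy]

lemma pos (he : Γ.IsEquilibrium D A e M) : 0 < M := by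
  obtain ⟨x, -, hx⟩ := Finset.exists_ne_zero_of_sum_ne_zero (he.charge.trans_ne one_ne_zero)
  refine lt_of_le_of_ne ((he.nonneg x).trans (he.le x)) fun hM => hx ?_
  have hzero (y : V) : e y = 0 := le_antisymm (hM ▸ he.le y) (he.nonneg y)
  exact lap_eq_zero_of_forall_adj fun y _ => by rw [hzero, hzero]

lemma sum_mul_lap_le (he : Γ.IsEquilibrium D A e M) (h : ∀ x ∈ Γ.innerBoundary A, f x ≤ c) :
    ∑ x ∈ D, f x * Γ.lap e x ≤ c := by
  calc ∑ x ∈ D, f x * Γ.lap e x ≤ ∑ x ∈ D, c * Γ.lap e x := by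
        refine Finset.sum_le_sum fun x hx => ?_
        by_cases h0 : Γ.lap e x = 0
        · rw [h0, mul_zero, mul_zero]
        · exact mul_le_mul_of_nonneg_right
            (h x (he.mem_innerBoundary_of_lap_ne_zero hx h0)) (he.lap_nonneg hx)
    _ = c := by rw [← Finset.mul_sum, he.charge, mul_one]

lemma le_sum_mul_lap (he : Γ.IsEquilibrium D A e M) (h : ∀ x ∈ Γ.innerBoundary A, c ≤ f x) :
    c ≤ ∑ x ∈ D, f x * Γ.lap e x := by
  have := he.sum_mul_lap_le (f := fun x => -f x) (c := -c) fun x hx => neg_le_neg (h x hx)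
  simp only [neg_mul, Finset.sum_neg_distrib] at this
  linarith

lemma sum_mul_lap_eq (he : Γ.IsEquilibrium D A e M) (h : ∀ x ∈ A, f x = c) :
    ∑ x ∈ D, f x * Γ.lap e x = c :=
  le_antisymm (he.sum_mul_lap_le fun x hx => (h x (innerBoundary_subset A hx)).le)
    (he.le_sum_mul_lap fun x hx => (h x (innerBoundary_subset A hx)).ge)

variable [Γ.graph.LocallyFinite]

lemma domination_principle [Infinite V] (he : Γ.IsEquilibrium D A e M)
    (he' : Γ.IsEquilibrium D A' e' M') (h : ∀ x ∈ A, c ≤ e' x) (p : V) : c - e' p ≤ M - e p := by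
  have hcM : c ≤ M :=
    calc c ≤ ∑ x ∈ D, e' x * Γ.lap e x :=
          he.le_sum_mul_lap fun x hx => h x (innerBoundary_subset A hx)
      _ = ∑ x ∈ D, e x * Γ.lap e' x := sum_mul_lap_comm he'.zero he.zero
      _ ≤ M := he'.sum_mul_lap_le fun x _ => he.le x
  have hoff (y : V) (hy : y ∉ (D : Set V) \ A) : c - M ≤ e' y - e y := by
    by_cases hyA : y ∈ A
    · linarith [h y hyA, he.eq y hyA]
    · have hyD : y ∉ D := fun hyD => hy ⟨hyD, hyA⟩
      linarith [he.zero y hyD, he'.zero y hyD]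
  have := le_of_le_off (Γ := Γ) (u := fun y => e' y - e y) (D.finite_toSet.subset Set.sdiff_subset)
    (fun x hx => by rw [lap_sub, he.lap_zero x hx.1 hx.2, sub_zero]; exact he'.lap_nonneg hx.1)
    hoff p
  linarith

end IsEquilibrium

variable [Γ.graph.LocallyFinite] [Infinite V] {D : Finset V} {A : Set V}

lemma exists_capacitary_potential (hAD : A ⊆ D) :
    ∃ f : V → ℝ, (∀ x ∈ A, f x = 1) ∧ (∀ x ∉ D, f x = 0) ∧ (∀ x, 0 ≤ f x) ∧ (∀ x, f x ≤ 1) ∧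
      ∀ x ∈ D, x ∉ A → Γ.lap f x = 0 := by
  have hW : ((D : Set V) \ A).Finite := D.finite_toSet.subset Set.sdiff_subset
  obtain ⟨f, hoff, hlap⟩ := exists_harmonic_extension (Γ := Γ) hW (A.indicator 1)
  have hnonneg (x : V) (hx : x ∉ (D : Set V) \ A) : 0 ≤ f x := by
    rw [hoff x hx]; exact Set.indicator_nonneg (fun _ _ => zero_le_one) x
  have hle_one (x : V) (hx : x ∉ (D : Set V) \ A) : 0 ≤ 1 - f x := by
    rw [hoff x hx, sub_nonneg]; exact Set.indicator_le_self' (fun _ _ => zero_le_one) x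
  refine ⟨f, fun x hx => ?_, fun x hx => ?_,
    le_of_le_off hW (fun x hx => (hlap x hx).ge) hnonneg,
    fun x => sub_nonneg.1 (le_of_le_off (Γ := Γ) hW (fun x hx => ?_) hle_one x),
    fun x hxD hxA => hlap x ⟨hxD, hxA⟩⟩
  · rw [hoff x fun h => h.2 hx, Set.indicator_of_mem hx, Pi.one_apply]
  · rw [hoff x fun h => hx h.1, Set.indicator_of_notMem fun h => hx (hAD h)]
  · rw [lap_const_sub, hlap x hx, neg_zero]

lemma exists_isEquilibrium (hA : A.Nonempty) (hAD : A ⊆ D) :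
    ∃ e M, Γ.IsEquilibrium D A e M := by
  obtain ⟨f, hfA, hfD, hf0, hf1, hlap⟩ := exists_capacitary_potential (Γ := Γ) hAD
  have hlap_nonneg (x : V) (hx : x ∈ D) : 0 ≤ Γ.lap f x := by
    by_cases hxA : x ∈ A
    · exact lap_nonneg_of_forall_le fun y => (hf1 y).trans_eq (hfA x hxA).symm
    · exact (hlap x hx hxA).ge
  set c := ∑ x ∈ D, Γ.lap f x with hc
  have hc_pos : 0 < c := by
    refine lt_of_le_of_ne (Finset.sum_nonneg hlap_nonneg) fun h0 => ?_
    have hzero := (Finset.sum_eq_zero_iff_of_nonneg hlap_nonneg).1 h0.symm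
    obtain ⟨a, ha⟩ := hA
    have := eq_zero_of_lap_eq_zero D.finite_toSet hzero hfD a
    linarith [hfA a ha]
  have hc_inv : 0 ≤ c⁻¹ := (inv_pos.2 hc_pos).le
  exact ⟨fun x => c⁻¹ * f x, c⁻¹,
    { subset := hAD
      eq := fun x hx => by rw [hfA x hx, mul_one]
      nonneg := fun x => mul_nonneg hc_inv (hf0 x)
      le := fun x => mul_le_of_le_one_right hc_inv (hf1 x)
      zero := fun x hx => by rw [hfD x hx, mul_zero]
      lap_zero := fun x hx hxA => by rw [lap_const_mul, hlap x hx hxA, mul_zero]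
      charge := by simp only [lap_const_mul, ← Finset.mul_sum, ← hc, inv_mul_cancel₀ hc_pos.ne'] }⟩

end Equilibrium

/-! ### Resistance -/

section Resistance

variable {D F : Finset V} {A : Set V} {e f : V → ℝ} {M : ℝ}

lemma IsEquilibrium.form_self (he : Γ.IsEquilibrium D A e M) (hF : Γ.closure D ⊆ F) :
    Γ.form F e e = M := by
  rw [form_eq_sum_mul_lap hF he.zero, he.sum_mul_lap_eq he.eq]

variable [Γ.graph.LocallyFinite]

lemma ofReal_le_resistance [Nontrivial V] (hF : Γ.closure D ⊆ F) (hfA : ∀ x ∈ A, f x = 1)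
    (hfD : ∀ x ∉ D, f x = 0) {c : ℝ} (hc : 0 < c) (h : Γ.form F f f ≤ c⁻¹) :
    ENNReal.ofReal c ≤ Γ.resistance A (D : Set V)ᶜ := by
  have hsupp : f.support.Finite := D.finite_toSet.subset fun x hx =>
    by_contra fun hxD => hx (hfD x hxD)
  rw [resistance, ENNReal.le_inv_iff_le_inv, ← ENNReal.ofReal_inv_of_pos hc]
  refine (iInf₂_le (Finsupp.ofSupportFinite f hsupp) ⟨hfA, hfD⟩).trans (ENNReal.ofReal_le_ofReal ?_)
  exact (innerMu_eq_form hF hfD).trans_le h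

lemma IsEquilibrium.resistance_eq [Nontrivial V] (he : Γ.IsEquilibrium D A e M) :
    Γ.resistance A (D : Set V)ᶜ = ENNReal.ofReal M := by
  obtain ⟨F, hF⟩ := exists_finset_closure_subset (Γ := Γ) D
  have hM := he.pos
  refine le_antisymm ?_ ?_
  · rw [resistance, ENNReal.inv_le_iff_inv_le, ← ENNReal.ofReal_inv_of_pos hM]
    refine le_iInf₂ fun f ⟨hfA, hfD⟩ => ENNReal.ofReal_le_ofReal ?_
    rw [innerMu_eq_form hF hfD, inv_le_iff_one_le_mul₀ hM]
    calc 1 = Γ.form F f e ^ 2 := by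
          rw [form_eq_sum_mul_lap hF hfD, he.sum_mul_lap_eq hfA, one_pow]
      _ ≤ Γ.form F f f * Γ.form F e e := form_cauchy_schwarz F f e
      _ = Γ.form F f f * M := by rw [he.form_self hF]
  · have hscale : Γ.form F (fun x => M⁻¹ * e x) (fun x => M⁻¹ * e x) = M⁻¹ := by
      rw [form_const_mul_self, he.form_self hF]
      field_simp
    exact ofReal_le_resistance hF (fun x hx => by rw [he.eq x hx, inv_mul_cancel₀ hM.ne'])
      (fun x hx => by rw [he.zero x hx, mul_zero]) hM hscale.le

lemma rho_eq_resistance (x : V) (r R : ℝ) :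
    Γ.rho x r R = Γ.resistance (Γ.ball x r) (Γ.ballFinset x R : Set V)ᶜ := by
  rw [rho, coe_ballFinset]

end Resistance

/-! ### Green functions -/

section Green

/-- `g` is the Green function of `D`: `g q` is the potential of a unit charge at `q`, that is, the
equilibrium potential of `{q}`. It is normalised so as to be symmetric, by dividing the expected
number of visits before leaving `D` by `μ`. -/
def IsGreen (Γ : WeightedGraph V) (D : Finset V) (g : V → V → ℝ) : Prop :=
  ∀ q ∈ D, Γ.IsEquilibrium D {q} (g q) (g q q)

variable {D D' : Finset V} {A A' : Set V} {g g' : V → V → ℝ} {e e' : V → ℝ} {M M' : ℝ} {p q : V}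

lemma IsGreen.lap_self (hg : Γ.IsGreen D g) (hp : p ∈ D) : Γ.lap (g p) p = 1 := by
  rw [← (hg p hp).charge]
  exact (Finset.sum_eq_single_of_mem p hp fun x hx hxp => (hg p hp).lap_zero x hx hxp).symm

lemma IsGreen.lap_of_ne (hg : Γ.IsGreen D g) (hp : p ∈ D) (hq : q ∈ D) (hqp : q ≠ p) :
    Γ.lap (g p) q = 0 :=
  (hg p hp).lap_zero q hq hqp

variable [Γ.graph.LocallyFinite]

lemma IsEquilibrium.eq_sum_green (he : Γ.IsEquilibrium D A e M) (hg : Γ.IsGreen D g)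
    (hq : q ∈ D) : e q = ∑ x ∈ D, g q x * Γ.lap e x := by
  rw [sum_mul_lap_comm (hg q hq).zero he.zero, (hg q hq).sum_mul_lap_eq (c := e q) (by simp)]

lemma IsGreen.symm (hg : Γ.IsGreen D g) (hp : p ∈ D) (hq : q ∈ D) : g p q = g q p := by
  rw [(hg p hp).eq_sum_green hg hq, (hg p hp).sum_mul_lap_eq (c := g q p) (by simp)]

lemma IsEquilibrium.le_mul_of_green_le (he : Γ.IsEquilibrium D A e M)
    (he' : Γ.IsEquilibrium D A' e' M') (hg : Γ.IsGreen D g) {x : V} (hx : x ∈ A) (hx' : x ∈ A')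
    {K : ℝ} (h : ∀ y ∈ Γ.innerBoundary A, ∀ y' ∈ Γ.innerBoundary A', g x y ≤ K * g x y') :
    M ≤ K * M' := by
  have hbound (y' : V) (hy' : y' ∈ Γ.innerBoundary A') : M ≤ K * g x y' := by
    rw [← he.eq x hx, he.eq_sum_green hg (he.subset hx)]
    exact he.sum_mul_lap_le fun y hy => h y hy y' hy'
  calc M ≤ ∑ y ∈ D, K * g x y * Γ.lap e' y := he'.le_sum_mul_lap hbound
    _ = K * e' x := by simp only [he'.eq_sum_green hg (he.subset hx), Finset.mul_sum, mul_assoc]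
    _ = K * M' := by rw [he'.eq x hx']

variable [Infinite V]

lemma exists_isGreen (D : Finset V) : ∃ g, Γ.IsGreen D g := by
  have hpotential (q : V) : ∃ u : V → ℝ, q ∈ D → Γ.IsEquilibrium D {q} u (u q) := by
    by_cases hq : q ∈ D
    · obtain ⟨u, M, hu⟩ := exists_isEquilibrium (Γ := Γ) (Set.singleton_nonempty q)
        (Set.singleton_subset_iff.2 hq)
      exact ⟨u, fun _ => (hu.eq q rfl).symm ▸ hu⟩
    · exact ⟨0, fun h => absurd h hq⟩
  choose g hg using hpotential
  exact ⟨g, hg⟩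

lemma IsGreen.le_sub_of_le_on_boundary (hg : Γ.IsGreen D g) (hg' : Γ.IsGreen D' g') (hD : D' ⊆ D)
    {m : ℝ} (hp : p ∈ D') (hm : ∀ y ∈ Γ.closure D' \ D', m ≤ g p y) :
    ∀ y ∈ Γ.closure D', g' p y ≤ g p y - m := by
  intro y hy
  have hharm (x : V) (hx : x ∈ D') : Γ.lap (fun y => g p y - g' p y) x = 0 := by
    rw [lap_sub]
    obtain rfl | hxp := eq_or_ne x p
    · rw [hg.lap_self (hD hx), hg'.lap_self hx, sub_self]
    · rw [hg.lap_of_ne (hD hp) (hD hx) hxp, hg'.lap_of_ne hp hx hxp, sub_self]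
  have := le_on_closure_of_le_on_boundary D'.finite_toSet (fun x hx => (hharm x hx).ge)
    (fun z hz => (hm z hz).trans_eq (by rw [(hg' p hp).zero z hz.2, sub_zero])) y hy
  linarith

/-- By the minimum principle in each variable, `g` is minimal at two boundary points. -/
lemma IsGreen.exists_boundary_le (hg : Γ.IsGreen D g) {W : Set V} (hW : W.Nonempty)
    (hWD : Γ.closure W ⊆ D) :
    ∃ p ∈ Γ.closure W \ W, ∃ q ∈ Γ.closure W \ W,
      ∀ y ∈ Γ.closure W, ∀ z ∈ Γ.closure W, g p q ≤ g y z := by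
  have hWD' : W ⊆ D := (subset_closure W).trans hWD
  have hWfin : W.Finite := D.finite_toSet.subset hWD'
  have hbd : (Γ.closure W \ W).Finite := (finite_closure hWfin).subset Set.sdiff_subset
  have hbd_ne : (Γ.closure W \ W).Nonempty := closure_diff_nonempty hWfin hW
  obtain ⟨⟨p, q⟩, ⟨hp, hq⟩, hmin⟩ := Set.exists_min_image _ (fun z : V × V => g z.1 z.2)
    (hbd.prod hbd) (hbd_ne.prod hbd_ne)
  refine ⟨p, hp, q, hq, fun y hy z hz => ?_⟩
  have extend (x : V) (hx : x ∈ Γ.closure W) (h : ∀ z ∈ Γ.closure W \ W, g p q ≤ g x z) :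
      ∀ z ∈ Γ.closure W, g p q ≤ g x z :=
    le_on_closure_of_le_on_boundary hWfin
      (fun z hz => (hg x (hWD hx)).lap_nonneg (hWD' hz)) h
  refine extend y hy (fun z hz => ?_) z hz
  rw [hg.symm (hWD hy) (hWD hz.1)]
  exact extend z hz.1 (fun y hy => hmin (z, y) ⟨hz, hy⟩) y hy

end Green

/-! ### Harnack chains -/

section Harnack

/-- The elliptic Harnack inequality with constant `H`, harmonicity being expressed by `lap`. -/
def HarnackWith (Γ : WeightedGraph V) (H : ℝ) : Prop :=
  ∀ (x : V) (R : ℝ), 0 < R → ∀ u : V → ℝ,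
    (∀ y ∈ Γ.closure (Γ.ball x (2 * R)), 0 ≤ u y) → (∀ y ∈ Γ.ball x (2 * R), Γ.lap u y = 0) →
      ∀ y ∈ Γ.ball x R, ∀ z ∈ Γ.ball x R, u y ≤ H * u z

lemma Harnack.exists_harnackWith [Nontrivial V] [Γ.graph.LocallyFinite] (h : Γ.Harnack) :
    ∃ H, Γ.HarnackWith H := by
  obtain ⟨H, -, hH⟩ := h
  exact ⟨H, fun x R hR u hu hlap => hH x R hR u hu (harmonicOn_iff_lap_eq_zero.2 hlap)⟩

/-- `k` behaves on `B` like a Green function: it is symmetric, non-negative, and harmonic in each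
variable away from the other one. Green functions of larger sets, also after subtraction of a lower
bound, are of this kind. -/
structure IsGreenKernel (Γ : WeightedGraph V) (B : Set V) (k : V → V → ℝ) : Prop where
  symm : ∀ p ∈ B, ∀ q ∈ B, k p q = k q p
  nonneg : ∀ p ∈ B, ∀ q ∈ Γ.closure B, 0 ≤ k p q
  lap_zero : ∀ p ∈ B, ∀ q ∈ B, q ≠ p → Γ.lap (k p) q = 0

lemma IsGreen.isGreenKernel_sub [Γ.graph.LocallyFinite] {D : Finset V} {g : V → V → ℝ}
    (hg : Γ.IsGreen D g) {B : Set V} (hB : B ⊆ D) {m : ℝ}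
    (hm : ∀ p ∈ B, ∀ q ∈ Γ.closure B, m ≤ g p q) :
    Γ.IsGreenKernel B fun p q => g p q - m where
  symm p hp q hq := by rw [hg.symm (hB hp) (hB hq)]
  nonneg p hp q hq := sub_nonneg.2 (hm p hp q hq)
  lap_zero p hp q hq hqp := by rw [lap_sub_const, hg.lap_of_ne (hB hp) (hB hq) hqp]

namespace HarnackWith

variable {H t : ℝ}

lemma one_le (hH : Γ.HarnackWith H) : 1 ≤ H := by
  obtain ⟨x⟩ := Γ.connected.nonempty
  have hx := mem_ball_self (Γ := Γ) x one_pos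
  simpa using hH x 1 one_pos (fun _ => 1) (fun _ _ => zero_le_one)
    (fun y _ => lap_eq_zero_of_forall_adj fun _ _ => rfl) x hx x hx

lemma le_pow_mul_of_segment (hH : Γ.HarnackWith H) (ht : 2 ≤ t) {S : Set V} {u : V → ℝ}
    (hu : ∀ z ∈ Γ.closure S, 0 ≤ u z) (hlap : ∀ z ∈ S, Γ.lap u z = 0) {p q : V} {n : ℕ}
    (hS : ∀ z ∈ Γ.segment p q, Γ.ball z (2 * t) ⊆ S) (hpq : Γ.dist p q ≤ n * (t / 2)) :
    u p ≤ H ^ n * u q := by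
  have hstep (z : V) (hz : z ∈ Γ.segment p q) (y : V) (hy : Γ.dist z y < t) : u z ≤ H * u y :=
    hH z t (by linarith) u (fun y hy => hu y (closure_mono (hS z hz) hy))
      (fun y hy => hlap y (hS z hz hy)) z (mem_ball_self z (by linarith)) y hy
  induction n generalizing p with
  | zero => rw [eq_of_dist_lt_one (x := p) (y := q) (by simp at hpq; linarith), pow_zero, one_mul]
  | succ n ih =>
    by_cases hnear : Γ.dist p q < t
    · have hq : 0 ≤ u q := hu q <| subset_closure S <|
        hS q (right_mem_segment p q) (mem_ball_self q (by linarith))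
      calc u p ≤ H * u q := hstep p (left_mem_segment p q) q hnear
        _ ≤ H ^ (n + 1) * u q :=
          mul_le_mul_of_nonneg_right (le_self_pow₀ hH.one_le n.succ_ne_zero) hq
    · obtain ⟨k, hk⟩ := Nat.exists_eq_succ_of_ne_zero (Nat.ceil_pos.2 (by linarith : 0 < t)).ne'
      have hk_lt := Nat.ceil_lt_add_one (by linarith : 0 ≤ t)
      have hk_ge := Nat.le_ceil t
      rw [hk] at hk_lt hk_ge
      push_cast at hk_lt hk_ge
      obtain ⟨z, hz, hpz⟩ := exists_mem_segment_dist_eq (Γ := Γ) (x := p) (y := q) (k := k)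
        (by linarith)
      have hsub := segment_subset_segment hz
      have hzq : Γ.dist z q ≤ n * (t / 2) := by
        have hz : Γ.dist p z + Γ.dist z q = Γ.dist p q := hz
        push_cast at hpq
        linarith
      calc u p ≤ H * u z := hstep p (left_mem_segment p q) z (by linarith)
        _ ≤ H * (H ^ n * u q) := mul_le_mul_of_nonneg_left
          (ih (fun w hw => hS w (hsub hw)) hzq fun w hw => hstep w (hsub hw))
          (by linarith [hH.one_le])
        _ = H ^ (n + 1) * u q := by ring

variable {x : V} {ℓ : ℝ} {k : V → V → ℝ} {n : ℕ}

lemma kernel_le_of_segment_avoids (hH : Γ.HarnackWith H) (ht : 2 ≤ t)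
    (hk : Γ.IsGreenKernel (Γ.ball x ℓ) k) (hn : ℓ ≤ n * (t / 2)) {a b c : V}
    (ha : a ∈ Γ.ball x ℓ) (hbc : Γ.dist x b + Γ.dist x c + 2 * t ≤ ℓ)
    (havoid : ∀ z ∈ Γ.segment b c, 2 * t ≤ Γ.dist a z) : k a b ≤ H ^ n * k a c := by
  refine hH.le_pow_mul_of_segment (S := Γ.ball x ℓ \ {a}) ht
    (fun z hz => hk.nonneg a ha z (closure_mono Set.sdiff_subset hz))
    (fun z hz => hk.lap_zero a ha z hz.1 hz.2)
    (fun z hz y hy => ⟨ball_subset_of_mem_segment hz hbc hy, ?_⟩) ?_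
  · rintro rfl
    linarith [havoid z hz, mem_ball.1 hy, Γ.dist_comm z y]
  · linarith [Γ.dist_triangle b x c, Γ.dist_comm b x]

/-- If the geodesic from `b` to `c` comes close to the pole `a`, one moves the pole instead. -/
lemma kernel_le (hH : Γ.HarnackWith H) (ht : 2 ≤ t) (hk : Γ.IsGreenKernel (Γ.ball x ℓ) k)
    (hn : ℓ ≤ n * (t / 2)) {a b c : V} (hab : Γ.dist x a + Γ.dist x b + 2 * t ≤ ℓ)
    (hac : Γ.dist x a + Γ.dist x c + 2 * t ≤ ℓ) (hbc : Γ.dist x b + Γ.dist x c + 2 * t ≤ ℓ)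
    (hab_far : 4 * t ≤ Γ.dist a b) (hac_far : 4 * t ≤ Γ.dist a c) :
    k a b ≤ H ^ (2 * n) * k a c := by
  have ha : a ∈ Γ.ball x ℓ := mem_ball.2 (by linarith [Γ.dist_nonneg x b])
  have hb : b ∈ Γ.ball x ℓ := mem_ball.2 (by linarith [Γ.dist_nonneg x a])
  have hc : c ∈ Γ.ball x ℓ := mem_ball.2 (by linarith [Γ.dist_nonneg x a])
  have hpow : 1 ≤ H ^ n := one_le_pow₀ hH.one_le
  rw [two_mul, pow_add]
  by_cases havoid : ∀ z ∈ Γ.segment b c, 2 * t ≤ Γ.dist a z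
  · calc k a b ≤ H ^ n * k a c := hH.kernel_le_of_segment_avoids ht hk hn ha hbc havoid
      _ ≤ H ^ n * H ^ n * k a c := mul_le_mul_of_nonneg_right
        (le_mul_of_one_le_left (by linarith) hpow) (hk.nonneg a ha c (subset_closure _ hc))
  · have havoid' : ¬∀ z ∈ Γ.segment c b, 2 * t ≤ Γ.dist a z := by rwa [segment_comm]
    have havoid_b := (segment_avoids_or_segment_avoids (by linarith) c).resolve_left havoid'
    have havoid_c := (segment_avoids_or_segment_avoids (by linarith) b).resolve_left havoid
    rw [segment_comm] at havoid_b
    calc k a b = k b a := hk.symm a ha b hb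
      _ ≤ H ^ n * k b c := hH.kernel_le_of_segment_avoids ht hk hn hb hac havoid_b
      _ = H ^ n * k c b := by rw [hk.symm b hb c hc]
      _ ≤ H ^ n * (H ^ n * k c a) := mul_le_mul_of_nonneg_left
        (hH.kernel_le_of_segment_avoids ht hk hn hc (by linarith) havoid_c) (by linarith)
      _ = H ^ n * H ^ n * k a c := by rw [hk.symm c hc a ha, mul_assoc]

/-- Both resistances are averages of the Green function with pole `x`, over points at distance about
`R` and `2R` respectively. -/
lemma rho_le_mul_rho_two_mul [Γ.graph.LocallyFinite] [Infinite V] (hH : Γ.HarnackWith H) (x : V)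
    {R : ℝ} (hR : 32 ≤ R) :
    Γ.rho x R (4 * R) ≤ ENNReal.ofReal (H ^ 256) * Γ.rho x (2 * R) (4 * R) := by
  have hD : (Γ.ballFinset x (4 * R) : Set V) = Γ.ball x (4 * R) := coe_ballFinset x _
  have hx {r : ℝ} (hr : 0 < r) : x ∈ Γ.ball x r := mem_ball_self x hr
  obtain ⟨e, M, he⟩ := exists_isEquilibrium (Γ := Γ) (D := Γ.ballFinset x (4 * R))
    ⟨x, hx (by linarith : 0 < R)⟩ (by rw [hD]; exact ball_subset_ball x (by linarith))
  obtain ⟨e', M', he'⟩ := exists_isEquilibrium (Γ := Γ) (D := Γ.ballFinset x (4 * R))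
    ⟨x, hx (by linarith : 0 < 2 * R)⟩ (by rw [hD]; exact ball_subset_ball x (by linarith))
  obtain ⟨g, hg⟩ := exists_isGreen (Γ := Γ) (Γ.ballFinset x (4 * R))
  have hk : Γ.IsGreenKernel (Γ.ball x (4 * R)) fun p q => g p q - 0 :=
    hg.isGreenKernel_sub hD.ge fun p hp q _ => (hg p (hD.ge hp)).nonneg q
  simp only [sub_zero] at hk
  have hM : M ≤ H ^ 256 * M' := by
    refine he.le_mul_of_green_le he' hg (hx (by linarith)) (hx (by linarith)) fun y hy z hz => ?_
    have hy_lt := mem_ball.1 (innerBoundary_subset _ hy)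
    have hz_lt := mem_ball.1 (innerBoundary_subset _ hz)
    have hy_ge := sub_one_le_dist_of_mem_innerBoundary_ball hy
    have hz_ge := sub_one_le_dist_of_mem_innerBoundary_ball hz
    have hxx := Γ.dist_self x
    exact hH.kernel_le (t := R / 16) (n := 128) (by linarith) hk (by norm_num; linarith)
      (by linarith) (by linarith) (by linarith) (by linarith) (by linarith)
  rw [rho_eq_resistance, rho_eq_resistance, he.resistance_eq, he'.resistance_eq,
    ← ENNReal.ofReal_mul (by linarith [one_le_pow₀ (n := 256) hH.one_le])]
  exact ENNReal.ofReal_le_ofReal hM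

end HarnackWith

end Harnack

/-! ### Balls at small resistance from each other -/

section Separated

variable {D : Finset V} {A : Set V} {e e' : V → ℝ} {M M' H t δ ε m : ℝ} {x a b z : V}
  {g : V → V → ℝ}

lemma IsGreen.sub_le_mul_sub (hg : Γ.IsGreen D g) (hH : Γ.HarnackWith H)
    (haD : Γ.ball a (2 * t) ⊆ D) (hz : z ∈ D) (haz : z ∉ Γ.ball a (2 * t))
    (hm : ∀ y ∈ Γ.closure (Γ.ball a (2 * t)), m ≤ g z y) :
    ∀ y ∈ Γ.ball a t, ∀ y' ∈ Γ.ball a t, g z y - m ≤ H * (g z y' - m) := by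
  intro y hy
  refine hH a t ((Γ.dist_nonneg a y).trans_lt hy) (fun y => g z y - m)
    (fun w hw => sub_nonneg.2 (hm w hw)) (fun w hw => ?_) y hy
  rw [lap_sub_const, hg.lap_of_ne hz (haD hw)]
  rintro rfl
  exact haz hw

variable [Γ.graph.LocallyFinite]

namespace HarnackWith

lemma sub_le_of_mem_ball (hH : Γ.HarnackWith H) (he : Γ.IsEquilibrium D (Γ.ball a t) e M)
    (hbD : Γ.ball b (2 * t) ⊆ D) (hab : 3 * t ≤ Γ.dist a b) {b₁ : V} (hb₁ : b₁ ∈ Γ.ball b t)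
    (hδ : M - e b₁ ≤ δ) : ∀ y ∈ Γ.ball b t, M - e y ≤ H * δ := by
  intro y hy
  have ht : 0 < t := (Γ.dist_nonneg b b₁).trans_lt hb₁
  calc M - e y ≤ H * (M - e b₁) := by
        refine hH b t ht (fun z => M - e z) (fun z _ => sub_nonneg.2 (he.le z))
          (fun z hz => ?_) y hy b₁ hb₁
        rw [lap_const_sub, he.lap_zero z (hbD hz) fun haz => ?_, neg_zero]
        linarith [mem_ball.1 hz, mem_ball.1 haz, Γ.dist_triangle a z b, Γ.dist_comm b z]
    _ ≤ H * δ := mul_le_mul_of_nonneg_left hδ (by linarith [hH.one_le])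

lemma sub_le_of_segment_avoids (hH : Γ.HarnackWith H) (ht : 2 ≤ t)
    (he : Γ.IsEquilibrium D (Γ.ball a t) e M) {ℓ : ℝ} (hD : Γ.ball x ℓ ⊆ D) {n : ℕ}
    (hn : ℓ ≤ n * (t / 2)) {p : V} (hpb : Γ.dist x p + Γ.dist x b + 2 * t ≤ ℓ)
    (havoid : ∀ z ∈ Γ.segment p b, 3 * t ≤ Γ.dist a z) : M - e p ≤ H ^ n * (M - e b) := by
  refine hH.le_pow_mul_of_segment (S := Γ.ball x ℓ \ Γ.ball a t) (u := fun z => M - e z) ht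
    (fun z _ => sub_nonneg.2 (he.le z)) (fun z hz => ?_)
    (fun z hz y hy => ⟨ball_subset_of_mem_segment hz hpb hy, fun hay => ?_⟩) ?_
  · rw [lap_const_sub, he.lap_zero z (hD hz.1) hz.2, neg_zero]
  · linarith [havoid z hz, mem_ball.1 hy, mem_ball.1 hay, Γ.dist_triangle a y z, Γ.dist_comm z y]
  · linarith [Γ.dist_triangle p x b, Γ.dist_comm p x]

variable [Infinite V]

/-- A point that cannot be joined to `b` while avoiding `a` can be joined to `a` while avoiding `b`;
in that case the bound is obtained for `e'` first, and carried over to `e` by domination. -/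
lemma sub_le_of_pair (hH : Γ.HarnackWith H) (ht : 2 ≤ t)
    (he : Γ.IsEquilibrium D (Γ.ball a t) e M) (he' : Γ.IsEquilibrium D (Γ.ball b t) e' M')
    (hab : 6 * t ≤ Γ.dist a b) {a₁ b₁ : V} (ha₁ : a₁ ∈ Γ.ball a t) (hb₁ : b₁ ∈ Γ.ball b t)
    (hδ : M - e b₁ ≤ δ) (hδ' : M' - e' a₁ ≤ δ) {ℓ : ℝ} (hD : Γ.ball x ℓ ⊆ D) {n : ℕ}
    (hn : ℓ ≤ n * (t / 2)) {p : V} (hpa : Γ.dist x p + Γ.dist x a + 2 * t ≤ ℓ)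
    (hpb : Γ.dist x p + Γ.dist x b + 2 * t ≤ ℓ) : M - e p ≤ 2 * H ^ (n + 1) * δ := by
  have hδ0 : 0 ≤ δ := (sub_nonneg.2 (he.le b₁)).trans hδ
  have hp0 : 0 ≤ Γ.dist x p := Γ.dist_nonneg x p
  have hball {c : V} (hc : Γ.dist x p + Γ.dist x c + 2 * t ≤ ℓ) : Γ.ball c (2 * t) ⊆ D :=
    (ball_subset_ball_of_dist_add_le (by linarith)).trans hD
  have hnear := hH.sub_le_of_mem_ball he (hball hpb) (by linarith) hb₁ hδ
  have hnear' := hH.sub_le_of_mem_ball he' (hball hpa) (by linarith [Γ.dist_comm a b]) ha₁ hδ'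
  have hpow0 : 0 ≤ H ^ n := pow_nonneg (by linarith [hH.one_le]) n
  have hpow : H * δ ≤ H ^ (n + 1) * δ :=
    mul_le_mul_of_nonneg_right (le_self_pow₀ hH.one_le n.succ_ne_zero) hδ0
  have hHδ : 0 ≤ H * δ := mul_nonneg (by linarith [hH.one_le]) hδ0
  rcases segment_avoids_or_segment_avoids (by linarith : 2 * (3 * t) ≤ Γ.dist a b) p with
    havoid | havoid
  · calc M - e p ≤ H ^ n * (M - e b) := hH.sub_le_of_segment_avoids ht he hD hn hpb havoid
      _ ≤ H ^ n * (H * δ) :=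
        mul_le_mul_of_nonneg_left (hnear b (mem_ball_self b (by linarith))) hpow0
      _ = H ^ (n + 1) * δ := by ring
      _ ≤ 2 * H ^ (n + 1) * δ := by linarith
  · have hfar : M' - e' p ≤ H ^ (n + 1) * δ :=
      calc M' - e' p ≤ H ^ n * (M' - e' a) := hH.sub_le_of_segment_avoids ht he' hD hn hpa havoid
        _ ≤ H ^ n * (H * δ) :=
          mul_le_mul_of_nonneg_left (hnear' a (mem_ball_self a (by linarith))) hpow0
        _ = H ^ (n + 1) * δ := by ring
    have hdom := he'.domination_principle he (c := M - H * δ)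
      (fun y hy => by linarith [hnear y hy]) p
    linarith

end HarnackWith

lemma IsEquilibrium.green_sub_le_mul_sub (he : Γ.IsEquilibrium D A e M) (hg : Γ.IsGreen D g)
    (hH : 0 < H) (hz : z ∈ D) (hharnack : ∀ y ∈ A, g z a - m ≤ H * (g z y - m)) :
    g z a - m ≤ H * (e z - m) := by
  have : m + (g z a - m) / H ≤ e z := by
    rw [he.eq_sum_green hg hz]
    refine he.le_sum_mul_lap fun y hy => ?_
    linarith [(div_le_iff₀' hH).2 (hharnack y (innerBoundary_subset _ hy))]
  exact (div_le_iff₀' hH).1 (by linarith)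

lemma IsEquilibrium.sub_le_mul_green_sub (he : Γ.IsEquilibrium D A e M) (hg : Γ.IsGreen D g)
    (hz : z ∈ D) {y : V} (hharnack : ∀ w ∈ A, g z w - m ≤ H * (g z y - m)) :
    e z - m ≤ H * (g z y - m) := by
  have : e z ≤ m + H * (g z y - m) := by
    rw [he.eq_sum_green hg hz]
    exact he.sum_mul_lap_le fun w hw => by linarith [hharnack w (innerBoundary_subset _ hw)]
  linarith

variable [Infinite V]

/-- The potential `g q` of `{q}` is at least about `M` on `A`, and this lower bound is carried over
to `p` by domination. -/
lemma IsEquilibrium.sub_green_le (he : Γ.IsEquilibrium D A e M) (hg : Γ.IsGreen D g)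
    (hH : 0 < H) {p q : V} (hp : p ∈ D) (hq : q ∈ D) (hpε : M - e p ≤ ε) (hqε : M - e q ≤ ε)
    (hharnack : ∀ y ∈ A, ∀ y' ∈ A, g q y - g p q ≤ H * (g q y' - g p q)) :
    M - g p q ≤ (1 + H) * ε := by
  have hlower (y : V) (hy : y ∈ A) : g p q + (e q - g p q) / H ≤ g q y := by
    have := he.sub_le_mul_green_sub hg hq fun w hw => hharnack w hw y hy
    linarith [(div_le_iff₀' hH).2 this]
  have hdom := he.domination_principle (hg q hq) hlower p
  rw [hg.symm hq hp] at hdom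
  have : e q - g p q ≤ H * ε := (div_le_iff₀' hH).1 (by linarith)
  linarith

lemma HarnackWith.exists_green_sub_le (hH : Γ.HarnackWith H) (hg : Γ.IsGreen D g)
    (he : Γ.IsEquilibrium D (Γ.ball a t) e M) {W : Set V} (hWD : Γ.closure W ⊆ D)
    (haW : Γ.ball a (2 * t) ⊆ W) (ht : 0 < t) (hε : ∀ p ∈ Γ.closure W, M - e p ≤ ε) :
    ∃ m, (∀ y ∈ Γ.closure W, ∀ z ∈ Γ.closure W, m ≤ g y z) ∧
      ∀ z ∈ W, z ∉ Γ.ball a (2 * t) → g z a - m ≤ H * ((1 + H) * ε) := by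
  have hH0 : 0 < H := one_pos.trans_le hH.one_le
  have ha {r : ℝ} (hr : 0 < r) : a ∈ Γ.ball a r := mem_ball_self a hr
  obtain ⟨p, hp, q, hq, hm⟩ := hg.exists_boundary_le ⟨a, haW (ha (by linarith))⟩ hWD
  have hharnack (z : V) (hz : z ∈ Γ.closure W) (haz : z ∉ Γ.ball a (2 * t)) :=
    hg.sub_le_mul_sub hH (haW.trans ((subset_closure W).trans hWD)) (hWD hz) haz
      fun y hy => hm z hz y (closure_mono haW hy)
  refine ⟨g p q, hm, fun z hz haz => ?_⟩
  have hz : z ∈ Γ.closure W := subset_closure W hz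
  calc g z a - g p q ≤ H * (e z - g p q) :=
        he.green_sub_le_mul_sub hg hH0 (hWD hz) fun y hy => hharnack z hz haz a (ha ht) y hy
    _ ≤ H * (M - g p q) := by gcongr; exact he.le z
    _ ≤ H * ((1 + H) * ε) := by
        gcongr
        exact he.sub_green_le hg hH0 (hWD hp.1) (hWD hq.1) (hε p hp.1) (hε q hq.1)
          (hharnack q hq.1 fun haq => hq.2 (haW haq))

variable {R : ℝ}

lemma HarnackWith.value_le_of_sub_le (hH : Γ.HarnackWith H) (hR : 32 ≤ R)
    (he : Γ.IsEquilibrium (Γ.ballFinset x (4 * R)) (Γ.ball x R) e M)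
    (he' : Γ.IsEquilibrium (Γ.ballFinset x (10 * R)) (Γ.ball a (R / 16)) e' M')
    (ha : Γ.dist x a ≤ 3 * R) (ha_far : R / 4 ≤ Γ.dist x a)
    (hε : ∀ p ∈ Γ.closure (Γ.ball x (5 * R)), M' - e' p ≤ ε) :
    M ≤ H ^ 320 * (H * ((1 + H) * ε)) := by
  have hx {r : ℝ} (hr : 0 < r) : x ∈ Γ.ball x r := mem_ball_self x hr
  have hWD : Γ.closure (Γ.ball x (5 * R)) ⊆ Γ.ballFinset x (10 * R) := fun y hy =>
    mem_ballFinset.2 (by linarith [dist_lt_of_mem_closure_ball hy])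
  obtain ⟨g, hg⟩ := exists_isGreen (Γ := Γ) (Γ.ballFinset x (10 * R))
  obtain ⟨g₄, hg₄⟩ := exists_isGreen (Γ := Γ) (Γ.ballFinset x (4 * R))
  obtain ⟨m, hm, hma⟩ := hH.exists_green_sub_le hg he' hWD
    (ball_subset_ball_of_dist_add_le (by linarith)) (by linarith) hε
  have hcoe : (Γ.ballFinset x (4 * R) : Set V) = Γ.ball x (4 * R) := coe_ballFinset x _
  have hg₄_le (y : V) (hy : y ∈ Γ.closure (Γ.ball x (4 * R))) : g₄ x y ≤ g x y - m := by
    refine hg.le_sub_of_le_on_boundary hg₄ (fun y hy => ?_) (he.subset (hx (by linarith)))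
      (fun y hy => ?_) y (hcoe ▸ hy)
    · exact mem_ballFinset.2 (by linarith [mem_ballFinset.1 hy])
    · rw [hcoe] at hy
      exact hm x (subset_closure _ (hx (by linarith))) y
        (closure_mono (ball_subset_ball x (by linarith)) hy.1)
  have hk : Γ.IsGreenKernel (Γ.ball x (5 * R)) fun p q => g p q - m :=
    hg.isGreenKernel_sub ((subset_closure _).trans hWD)
      fun p hp q hq => hm p (subset_closure _ hp) q hq
  rw [← he.eq x (hx (by linarith)), he.eq_sum_green hg₄ (he.subset (hx (by linarith)))]
  refine he.sum_mul_lap_le fun y hy => ?_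
  have hy_lt := mem_ball.1 (innerBoundary_subset _ hy)
  have hy_ge := sub_one_le_dist_of_mem_innerBoundary_ball hy
  have hxx := Γ.dist_self x
  calc g₄ x y ≤ g x y - m := hg₄_le y (subset_closure _ (mem_ball.2 (by linarith)))
    _ ≤ H ^ (2 * 160) * (g x a - m) :=
      hH.kernel_le (t := R / 16) (n := 160) (by linarith) hk (by norm_num; linarith)
        (by linarith) (by linarith) (by linarith) (by linarith) (by linarith)
    _ ≤ H ^ 320 * (H * ((1 + H) * ε)) := by
      refine mul_le_mul_of_nonneg_left ?_ (pow_nonneg (by linarith [hH.one_le]) 320)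
      exact hma x (hx (by linarith)) fun hxa => by
        linarith [mem_ball.1 hxa, Γ.dist_comm a x]

/-- One of the two balls has its centre far from `x`, as `value_le_of_sub_le` requires. -/
lemma HarnackWith.value_le_of_pair (hH : Γ.HarnackWith H) (hR : 32 ≤ R) {M₁ M₂ : ℝ} {e₁ e₂ : V → ℝ}
    (he : Γ.IsEquilibrium (Γ.ballFinset x (4 * R)) (Γ.ball x R) e M)
    (he₁ : Γ.IsEquilibrium (Γ.ballFinset x (10 * R)) (Γ.ball a (R / 16)) e₁ M₁)
    (he₂ : Γ.IsEquilibrium (Γ.ballFinset x (10 * R)) (Γ.ball b (R / 16)) e₂ M₂)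
    (ha : Γ.dist x a ≤ 3 * R) (hb : Γ.dist x b ≤ 3 * R) (hab : R / 2 ≤ Γ.dist a b) {a₁ b₁ : V}
    (ha₁ : a₁ ∈ Γ.ball a (R / 16)) (hb₁ : b₁ ∈ Γ.ball b (R / 16)) (hδ₁ : M₁ - e₁ b₁ ≤ δ)
    (hδ₂ : M₂ - e₂ a₁ ≤ δ) : M ≤ 4 * H ^ 643 * δ := by
  wlog ha_far : R / 4 ≤ Γ.dist x a generalizing a b M₁ M₂ e₁ e₂ a₁ b₁
  · refine this he₂ he₁ hb ha (by rwa [dist_comm]) hb₁ ha₁ hδ₂ hδ₁ ?_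
    linarith [Γ.dist_triangle a x b, Γ.dist_comm a x]
  have hε (p : V) (hp : p ∈ Γ.closure (Γ.ball x (5 * R))) : M₁ - e₁ p ≤ 2 * H ^ (320 + 1) * δ := by
    have hp := dist_lt_of_mem_closure_ball hp
    exact hH.sub_le_of_pair (by linarith) he₁ he₂ (by linarith) ha₁ hb₁ hδ₁ hδ₂
      (coe_ballFinset x (10 * R)).ge (by norm_num; linarith) (by linarith) (by linarith)
  have hδ0 : 0 ≤ δ := (sub_nonneg.2 (he₁.le b₁)).trans hδ₁
  have hH1 := hH.one_le
  calc M ≤ H ^ 320 * (H * ((1 + H) * (2 * H ^ 321 * δ))) :=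
        hH.value_le_of_sub_le hR he he₁ ha ha_far hε
    _ ≤ H ^ 320 * (H * ((H + H) * (2 * H ^ 321 * δ))) := by gcongr
    _ = 4 * H ^ 643 * δ := by ring

end Separated

/-! ### Cut-off functions and coverings -/

section Cutoff

variable {D F : Finset V} {A B : Set V} {e φ : V → ℝ} {M c δ : ℝ}

lemma form_le_form {f g f' g' : V → ℝ} (h : ∀ x ∈ F, ∀ y ∈ F, Γ.graph.Adj x y →
    (f x - f y) * (g x - g y) ≤ (f' x - f' y) * (g' x - g' y)) :
    Γ.form F f g ≤ Γ.form F f' g' := by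
  refine div_le_div_of_nonneg_right (Finset.sum_le_sum fun x hx => Finset.sum_le_sum fun y hy => ?_)
    zero_le_two
  by_cases hxy : Γ.graph.Adj x y
  · exact mul_le_mul_of_nonneg_left (h x hx y hy hxy) (w_nonneg x y)
  · rw [Γ.w_zero x y hxy, zero_mul, zero_mul]

lemma form_one_sub (F : Finset V) (f : V → ℝ) :
    Γ.form F (fun x => 1 - f x) (fun x => 1 - f x) = Γ.form F f f := by
  simp only [form, sub_sub_sub_cancel_left]
  congr 1
  exact Finset.sum_congr rfl fun x _ => Finset.sum_congr rfl fun y _ => by ring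

lemma form_min_le (F : Finset V) (f g : V → ℝ) :
    Γ.form F (fun x => min (f x) (g x)) (fun x => min (f x) (g x)) ≤
      Γ.form F f f + Γ.form F g g := by
  simp only [form, ← add_div, ← Finset.sum_add_distrib, ← mul_add]
  refine div_le_div_of_nonneg_right (Finset.sum_le_sum fun x _ => Finset.sum_le_sum fun y _ =>
    mul_le_mul_of_nonneg_left ?_ (w_nonneg x y)) zero_le_two
  have hmax := abs_min_sub_min_le_max (f x) (g x) (f y) (g y)
  have hsq : (min (f x) (g x) - min (f y) (g y)) ^ 2 ≤
      max ((f x - f y) ^ 2) ((g x - g y) ^ 2) := by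
    rcases le_max_iff.1 hmax with h | h
    · exact le_max_of_le_left (sq_le_sq.2 h)
    · exact le_max_of_le_right (sq_le_sq.2 h)
  simp only [← sq]
  exact hsq.trans (max_le_add_of_nonneg (sq_nonneg _) (sq_nonneg _))

lemma form_indicator_le (hφ : ∀ x ∈ Γ.innerBoundary A, φ x = 0) :
    Γ.form F (A.indicator φ) (A.indicator φ) ≤ Γ.form F φ φ := by
  have hcross {x y : V} (hxy : Γ.graph.Adj x y) (hx : x ∈ A) (hy : y ∉ A) : φ x = 0 :=
    hφ x ⟨hx, y, hy, hxy⟩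
  refine form_le_form fun x _ y _ hxy => ?_
  simp only [← sq]
  by_cases hx : x ∈ A <;> by_cases hy : y ∈ A <;>
    simp only [hx, hy, not_false_eq_true, Set.indicator_of_mem, Set.indicator_of_notMem, le_refl]
  · simp only [hcross hxy hx hy, sub_zero, ne_eq, OfNat.ofNat_ne_zero, not_false_eq_true, zero_pow]
    exact sq_nonneg _
  · simp only [hcross hxy.symm hy hx, sub_zero, ne_eq, OfNat.ofNat_ne_zero, not_false_eq_true,
      zero_pow]
    exact sq_nonneg _
  · simp only [sub_zero, ne_eq, OfNat.ofNat_ne_zero, not_false_eq_true, zero_pow]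
    exact sq_nonneg _

/-- `φ` is a cut-off function, equal to `1` on `A` and to `0` on `B`, of energy at most `c` in the
network induced on `F`. -/
structure IsCutoff (Γ : WeightedGraph V) (F : Finset V) (A B : Set V) (c : ℝ) (φ : V → ℝ) :
    Prop where
  nonneg : ∀ x, 0 ≤ φ x
  le_one : ∀ x, φ x ≤ 1
  one : ∀ x ∈ A, φ x = 1
  zero : ∀ x ∈ B, φ x = 0
  form_le : Γ.form F φ φ ≤ c

lemma IsCutoff.mono (h : Γ.IsCutoff F A B c φ) {A' B' : Set V} {c' : ℝ} (hA : A' ⊆ A)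
    (hB : B' ⊆ B) (hc : c ≤ c') : Γ.IsCutoff F A' B' c' φ :=
  ⟨h.nonneg, h.le_one, fun x hx => h.one x (hA hx), fun x hx => h.zero x (hB hx),
    h.form_le.trans hc⟩

lemma IsCutoff.one_sub (h : Γ.IsCutoff F A B c φ) : Γ.IsCutoff F B A c fun x => 1 - φ x where
  nonneg x := sub_nonneg.2 (h.le_one x)
  le_one x := sub_le_self _ (h.nonneg x)
  one x hx := by rw [h.zero x hx, sub_zero]
  zero x hx := by rw [h.one x hx, sub_self]
  form_le := by rw [form_one_sub]; exact h.form_le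

lemma exists_isCutoff_biUnion_right {U : V → Set V} (s : Finset V)
    (h : ∀ b ∈ s, ∃ φ, Γ.IsCutoff F A (U b) c φ) :
    ∃ φ, Γ.IsCutoff F A (⋃ b ∈ s, U b) (s.card * c) φ := by
  classical
  induction s using Finset.induction_on with
  | empty =>
    exact ⟨fun _ => 1, fun _ => zero_le_one, fun _ => le_rfl, fun _ _ => rfl, by simp,
      by simp [form]⟩
  | insert b s hb ih =>
    obtain ⟨φ, hφ⟩ := ih fun b hb => h b (Finset.mem_insert_of_mem hb)
    obtain ⟨ψ, hψ⟩ := h b (Finset.mem_insert_self b s)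
    refine ⟨fun x => min (φ x) (ψ x), fun x => le_min (hφ.nonneg x) (hψ.nonneg x),
      fun x => (min_le_left _ _).trans (hφ.le_one x),
      fun x hx => by rw [hφ.one x hx, hψ.one x hx, min_self], fun x hx => ?_, ?_⟩
    · rcases Finset.set_biUnion_insert b s U ▸ hx with hx | hx
      · rw [hψ.zero x hx, min_eq_right (hφ.nonneg x)]
      · rw [hφ.zero x hx, min_eq_left (hψ.nonneg x)]
    · rw [Finset.card_insert_of_notMem hb]
      push_cast
      linarith [form_min_le (Γ := Γ) F φ ψ, hφ.form_le, hψ.form_le]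

lemma exists_isCutoff_biUnion {U U' : V → Set V} (s s' : Finset V)
    (h : ∀ a ∈ s, ∀ b ∈ s', ∃ φ, Γ.IsCutoff F (U a) (U' b) c φ) :
    ∃ φ, Γ.IsCutoff F (⋃ a ∈ s, U a) (⋃ b ∈ s', U' b) (s.card * (s'.card * c)) φ := by
  obtain ⟨φ, hφ⟩ := exists_isCutoff_biUnion_right (Γ := Γ) (F := F) (A := ⋃ b ∈ s', U' b) (U := U)
    s fun a ha => by
      obtain ⟨φ, hφ⟩ := exists_isCutoff_biUnion_right s' (h a ha)
      exact ⟨_, hφ.one_sub⟩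
  exact ⟨_, hφ.one_sub⟩

lemma exists_isCutoff_of_cover {U : V → Set V} {s : Finset V} (hA : A ⊆ ⋃ a ∈ s, U a)
    (hB : B ⊆ ⋃ b ∈ s, U b) (hc : 0 ≤ c) (h : ∀ a b, (A ∩ U a).Nonempty → (B ∩ U b).Nonempty →
      ∃ φ, Γ.IsCutoff F (U a) (U b) c φ) :
    ∃ φ, Γ.IsCutoff F A B (s.card ^ 2 * c) φ := by
  classical
  have hmeet {S : Set V} (hS : S ⊆ ⋃ a ∈ s, U a) :
      S ⊆ ⋃ a ∈ s.filter fun a => (S ∩ U a).Nonempty, U a := fun y hy => by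
    obtain ⟨a, ha, hya⟩ := Set.mem_iUnion₂.1 (hS hy)
    exact Set.mem_iUnion₂.2 ⟨a, Finset.mem_filter.2 ⟨ha, y, hy, hya⟩, hya⟩
  have hcard (p : V → Prop) [DecidablePred p] : ((s.filter p).card : ℝ) ≤ s.card :=
    Nat.cast_le.2 (Finset.card_filter_le _ _)
  obtain ⟨φ, hφ⟩ := exists_isCutoff_biUnion (s.filter fun a => (A ∩ U a).Nonempty)
    (s.filter fun b => (B ∩ U b).Nonempty)
    fun a ha b hb => h a b (Finset.mem_filter.1 ha).2 (Finset.mem_filter.1 hb).2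
  refine ⟨φ, hφ.mono (hmeet hA) (hmeet hB) ?_⟩
  rw [sq, mul_assoc]
  exact mul_le_mul (hcard _) (mul_le_mul_of_nonneg_right (hcard _) hc)
    (mul_nonneg (Nat.cast_nonneg _) hc) (Nat.cast_nonneg _)

lemma IsEquilibrium.exists_isCutoff (he : Γ.IsEquilibrium D A e M) (hF : Γ.closure D ⊆ F)
    (hδ : 0 < δ) (hδM : δ ≤ M) (hB : ∀ b ∈ B, δ ≤ M - e b) :
    ∃ φ, Γ.IsCutoff F A B δ⁻¹ φ := by
  let ψ : V → ℝ := fun x => max (e x - (M - δ)) 0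
  have hψA (x : V) (hx : x ∈ A) : ψ x = δ := by
    simp only [ψ, he.eq x hx, sub_sub_cancel, max_eq_left hδ.le]
  have hψ_zero {x : V} (hx : δ ≤ M - e x) : ψ x = 0 := max_eq_right (by linarith)
  have henergy : Γ.form F ψ ψ ≤ δ := by
    calc Γ.form F ψ ψ ≤ Γ.form F ψ e := by
          refine form_le_form fun x _ y _ _ => ?_
          rcases le_total (e x - (M - δ)) 0 with hx | hx <;>
            rcases le_total (e y - (M - δ)) 0 with hy | hy <;>
            simp only [ψ, max_eq_left, max_eq_right, hx, hy] <;> nlinarith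
      _ = ∑ x ∈ D, ψ x * Γ.lap e x :=
        form_eq_sum_mul_lap hF (fun x hx => hψ_zero (by rwa [he.zero x hx, sub_zero])) e
      _ = δ := he.sum_mul_lap_eq hψA
  refine ⟨fun x => δ⁻¹ * ψ x, fun x => mul_nonneg (inv_pos.2 hδ).le (le_max_right _ _), fun x => ?_,
    fun x hx => by rw [hψA x hx, inv_mul_cancel₀ hδ.ne'],
    fun x hx => by rw [hψ_zero (hB x hx), mul_zero], ?_⟩
  · rw [inv_mul_le_iff₀ hδ, mul_one]
    exact max_le (by linarith [he.le x]) hδ.le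
  · rw [form_const_mul_self]
    calc δ⁻¹ ^ 2 * Γ.form F ψ ψ ≤ δ⁻¹ ^ 2 * δ := by gcongr
      _ = δ⁻¹ := by field_simp

lemma BoundedCovering.exists_cover (h : Γ.BoundedCovering) : ∃ K : ℕ, ∀ (j : ℕ) (x : V) (R : ℝ),
    0 < R → ∃ s : Finset V, s.card ≤ K ^ j ∧ Γ.ball x (2 ^ j * R) ⊆ ⋃ c ∈ s, Γ.ball c R := by
  classical
  obtain ⟨K, hK⟩ := h
  refine ⟨K, fun j => ?_⟩
  induction j with
  | zero => exact fun x R _ => ⟨{x}, by simp, by simp⟩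
  | succ j ih =>
    intro x R hR
    obtain ⟨s, hs, hcover⟩ := ih x (2 * R) (by linarith)
    choose t ht htcover using fun c : V => hK c R hR
    refine ⟨s.biUnion t, ?_, ?_⟩
    · calc (s.biUnion t).card ≤ s.card * K := Finset.card_biUnion_le_card_mul _ _ _ fun c _ => ht c
        _ ≤ K ^ j * K := Nat.mul_le_mul_right _ hs
        _ = K ^ (j + 1) := (pow_succ _ _).symm
    · rw [pow_succ, mul_assoc, Finset.set_biUnion_biUnion]
      exact hcover.trans (Set.iUnion₂_mono fun c _ => htcover c)

variable [Γ.graph.LocallyFinite] [Infinite V] {H R : ℝ} {x a b : V}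

lemma HarnackWith.exists_isCutoff_ball (hH : Γ.HarnackWith H) (hR : 32 ≤ R)
    (he : Γ.IsEquilibrium (Γ.ballFinset x (4 * R)) (Γ.ball x R) e M)
    (ha : Γ.dist x a ≤ 3 * R) (hb : Γ.dist x b ≤ 3 * R) (hab : R / 2 ≤ Γ.dist a b)
    (hF : Γ.closure (Γ.ballFinset x (10 * R)) ⊆ F) :
    ∃ φ, Γ.IsCutoff F (Γ.ball a (R / 16)) (Γ.ball b (R / 16)) (4 * H ^ 643 / M) φ := by
  have hself (c : V) : c ∈ Γ.ball c (R / 16) := mem_ball_self c (by linarith)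
  have hequilibrium {c : V} (hc : Γ.dist x c ≤ 3 * R) :
      ∃ e M, Γ.IsEquilibrium (Γ.ballFinset x (10 * R)) (Γ.ball c (R / 16)) e M :=
    exists_isEquilibrium ⟨c, hself c⟩ fun y hy =>
      mem_ballFinset.2 (by linarith [mem_ball.1 hy, Γ.dist_triangle x c y])
  obtain ⟨e₁, M₁, he₁⟩ := hequilibrium ha
  obtain ⟨e₂, M₂, he₂⟩ := hequilibrium hb
  have hM := he.pos
  have hC : 0 < 4 * H ^ 643 := mul_pos four_pos (pow_pos (one_pos.trans_le hH.one_le) 643)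
  rw [← inv_div M]
  have hδ := div_pos hM hC
  by_cases hb₁ : ∀ b₁ ∈ Γ.ball b (R / 16), M / (4 * H ^ 643) ≤ M₁ - e₁ b₁
  · exact he₁.exists_isCutoff hF hδ (by linarith [hb₁ b (hself b), he₁.nonneg b]) hb₁
  · push Not at hb₁
    obtain ⟨b₁, hb₁, hδ₁⟩ := hb₁
    have ha₁ (a₁ : V) (ha₁ : a₁ ∈ Γ.ball a (R / 16)) : M / (4 * H ^ 643) ≤ M₂ - e₂ a₁ := by
      by_contra! hδ₂
      have := hH.value_le_of_pair hR he he₁ he₂ ha hb hab ha₁ hb₁ (le_max_left _ _)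
        (le_max_right _ _)
      exact (max_lt hδ₁ hδ₂).not_ge ((div_le_iff₀' hC).2 this)
    obtain ⟨φ, hφ⟩ := he₂.exists_isCutoff hF hδ (by linarith [ha₁ a (hself a), he₂.nonneg a]) ha₁
    exact ⟨_, hφ.one_sub⟩

lemma IsCutoff.ofReal_inv_le_rho {r : ℝ}
    (hφ : Γ.IsCutoff F (Γ.ball x r) (Γ.innerBoundary (Γ.ball x R)) c φ)
    (hF : Γ.closure (Γ.ballFinset x R) ⊆ F) (hr : r ≤ R) (hc : 0 < c) :
    ENNReal.ofReal c⁻¹ ≤ Γ.rho x r R := by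
  rw [rho_eq_resistance]
  refine ofReal_le_resistance (f := (Γ.ball x R).indicator φ) hF (fun y hy => ?_) (fun y hy => ?_)
    (inv_pos.2 hc) ?_
  · rw [Set.indicator_of_mem (ball_subset_ball x hr hy), hφ.one y hy]
  · exact Set.indicator_of_notMem (fun h : y ∈ Γ.ball x R => hy (mem_ballFinset.2 h)) φ
  · rw [inv_inv]
    exact (form_indicator_le hφ.zero).trans hφ.form_le

lemma HarnackWith.rho_le_mul_rho_of_cover (hH : Γ.HarnackWith H) {s : Finset V} (hR : 32 ≤ R)
    (hs : Γ.ball x (2 * R) ⊆ ⋃ c ∈ s, Γ.ball c (R / 16)) :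
    Γ.rho x R (4 * R) ≤ ENNReal.ofReal (s.card ^ 2 * (4 * H ^ 643)) * Γ.rho x R (2 * R) := by
  have hx {r : ℝ} (hr : 0 < r) : x ∈ Γ.ball x r := mem_ball_self x hr
  obtain ⟨e, M, he⟩ := exists_isEquilibrium (Γ := Γ) (D := Γ.ballFinset x (4 * R))
    ⟨x, hx (by linarith : 0 < R)⟩ (by rw [coe_ballFinset]; exact ball_subset_ball x (by linarith))
  obtain ⟨F, hF⟩ := exists_finset_closure_subset (Γ := Γ) (Γ.ballFinset x (10 * R))
  have hM := he.pos
  have hC : 0 < 4 * H ^ 643 := mul_pos four_pos (pow_pos (one_pos.trans_le hH.one_le) 643)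
  obtain ⟨φ, hφ⟩ := exists_isCutoff_of_cover (Γ := Γ) (F := F) (A := Γ.ball x R)
    (B := Γ.innerBoundary (Γ.ball x (2 * R)))
    ((ball_subset_ball x (by linarith)).trans hs) ((innerBoundary_subset _).trans hs)
    (div_pos hC hM).le fun a b ⟨y, hy, hay⟩ ⟨z, hz, hbz⟩ => by
      have hz_ge := sub_one_le_dist_of_mem_innerBoundary_ball hz
      rw [mem_ball] at hy hay hbz
      have hz := mem_ball.1 (innerBoundary_subset _ hz)
      exact hH.exists_isCutoff_ball hR he
        (by linarith [Γ.dist_triangle x y a, Γ.dist_comm a y])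
        (by linarith [Γ.dist_triangle x z b, Γ.dist_comm b z])
        (by linarith [Γ.dist_triangle x y a, Γ.dist_comm a y, Γ.dist_triangle x a z,
          Γ.dist_triangle a b z]) hF
  obtain ⟨c, hc, -⟩ := Set.mem_iUnion₂.1 (hs (hx (by linarith)))
  have hN : 0 < (s.card ^ 2 * (4 * H ^ 643) : ℝ) :=
    mul_pos (pow_pos (Nat.cast_pos.2 (Finset.card_pos.2 ⟨c, hc⟩)) 2) hC
  have hlower : ENNReal.ofReal (M / (s.card ^ 2 * (4 * H ^ 643))) ≤ Γ.rho x R (2 * R) := by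
    rw [← inv_div, mul_div_assoc]
    refine hφ.ofReal_inv_le_rho ((closure_mono fun y hy => ?_).trans hF) (by linarith)
      (mul_div_assoc (_ : ℝ) _ M ▸ div_pos hN hM)
    exact mem_ballFinset.2 (by linarith [mem_ballFinset.1 hy])
  calc Γ.rho x R (4 * R) = ENNReal.ofReal M := by rw [rho_eq_resistance, he.resistance_eq]
    _ = ENNReal.ofReal (s.card ^ 2 * (4 * H ^ 643)) *
        ENNReal.ofReal (M / (s.card ^ 2 * (4 * H ^ 643))) := by
      rw [← ENNReal.ofReal_mul hN.le, mul_div_cancel₀ _ hN.ne']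
    _ ≤ _ := by gcongr

lemma HarnackWith.exists_rho_le_mul_rho_of_boundedCovering (hH : Γ.HarnackWith H)
    (hBC : Γ.BoundedCovering) : ∃ C : ℝ, ∀ x R, 32 ≤ R →
      Γ.rho x R (4 * R) ≤ ENNReal.ofReal C * Γ.rho x R (2 * R) := by
  obtain ⟨K, hK⟩ := hBC.exists_cover
  refine ⟨((K ^ 5 : ℕ) : ℝ) ^ 2 * (4 * H ^ 643), fun x R hR => ?_⟩
  obtain ⟨s, hs, hcover⟩ := hK 5 x (R / 16) (by linarith)
  rw [show 2 ^ 5 * (R / 16) = 2 * R by ring] at hcover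
  refine (hH.rho_le_mul_rho_of_cover hR hcover).trans ?_
  have := one_pos.trans_le hH.one_le
  gcongr

end Cutoff

/-! ### Annuli of bounded size -/

section BoundedSize

/-- Condition `(p₀)` with a given constant `p₀`, in a form that involves no division. -/
structure P0With (Γ : WeightedGraph V) (p₀ : ℝ) : Prop where
  pos : 0 < p₀
  mul_mu_le : ∀ {x y}, Γ.graph.Adj x y → p₀ * Γ.mu x ≤ Γ.w x y

lemma P0.exists_p0With [Nontrivial V] (h : Γ.P0) : ∃ p₀, Γ.P0With p₀ := by
  obtain ⟨p₀, hpos, hp⟩ := h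
  exact ⟨p₀, hpos, fun {x y} hxy => (le_div_iff₀ (mu_pos x)).1 (hp x y hxy)⟩

lemma sum_w_le_mu (x : V) (F : Finset V) : ∑ y ∈ F, Γ.w x y ≤ Γ.mu x :=
  (Γ.w_summable x).sum_le_tsum F fun y _ => w_nonneg x y

lemma form_indicator_one_le {S F : Finset V} (hS : S ⊆ F) :
    Γ.form F (Set.indicator S 1) (Set.indicator S 1) ≤ ∑ x ∈ S, Γ.mu x := by
  rw [form_eq_sum, ← Finset.sum_subset hS fun x _ hx => by simp [hx]]
  refine Finset.sum_le_sum fun x hx => ?_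
  rw [Set.indicator_of_mem (Finset.mem_coe.2 hx), Pi.one_apply, one_mul]
  refine (Finset.sum_le_sum fun y _ => ?_).trans (sum_w_le_mu x F)
  exact mul_le_of_le_one_right (w_nonneg x y)
    (sub_le_self _ (Set.indicator_nonneg (fun _ _ => zero_le_one) y))

lemma abs_sub_le_mul_dist {f : V → ℝ} {c : ℝ}
    (h : ∀ x y, Γ.graph.Adj x y → |f x - f y| ≤ c) (x y : V) : |f x - f y| ≤ c * Γ.dist x y := by
  have hwalk {x y : V} (p : Γ.graph.Walk x y) : |f x - f y| ≤ c * p.length := by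
    induction p with
    | nil => simp
    | @cons u v w huv p ih =>
      rw [SimpleGraph.Walk.length_cons]
      push_cast
      linarith [abs_sub_le (f u) (f v) (f w), h u v huv]
  obtain ⟨p, hp⟩ := Γ.connected.exists_walk_length_eq_dist x y
  rw [dist, ← hp]
  exact hwalk p

namespace P0With

variable {p₀ : ℝ}

lemma finite_neighborSet [Nontrivial V] (hp : Γ.P0With p₀) (x : V) :
    (Γ.graph.neighborSet x).Finite := by
  have hsmall := (Γ.w_summable x).tendsto_cofinite_zero.eventually_lt_const
    (mul_pos hp.pos (mu_pos (Γ := Γ) x))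
  exact (Filter.eventually_cofinite.1 hsmall).subset fun y hy => not_lt.2 (hp.mul_mu_le hy)

lemma sum_mu_le_of_subset_closure (hp : Γ.P0With p₀) {S T : Finset V} (hST : S ⊆ T)
    (hT : (T : Set V) ⊆ Γ.closure S) :
    ∑ y ∈ T, Γ.mu y ≤ (1 + p₀⁻¹) * ∑ x ∈ S, Γ.mu x := by
  classical
  have hboundary {y : V} (hy : y ∈ T \ S) : Γ.mu y ≤ p₀⁻¹ * ∑ x ∈ S, Γ.w x y := by
    obtain ⟨hyT, hyS⟩ := Finset.mem_sdiff.1 hy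
    obtain ⟨x, hx, hxy⟩ := (hT hyT).resolve_left hyS
    rw [le_inv_mul_iff₀ hp.pos]
    calc p₀ * Γ.mu y ≤ Γ.w x y := (hp.mul_mu_le hxy.symm).trans_eq (Γ.w_symm y x)
      _ ≤ ∑ x ∈ S, Γ.w x y :=
        Finset.single_le_sum (f := fun x => Γ.w x y) (fun x _ => w_nonneg x y) hx
  calc ∑ y ∈ T, Γ.mu y = ∑ y ∈ T \ S, Γ.mu y + ∑ y ∈ S, Γ.mu y := (Finset.sum_sdiff hST).symm
    _ ≤ ∑ y ∈ T \ S, p₀⁻¹ * ∑ x ∈ S, Γ.w x y + ∑ y ∈ S, Γ.mu y :=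
      add_le_add_left (Finset.sum_le_sum fun y hy => hboundary hy) _
    _ = p₀⁻¹ * ∑ x ∈ S, ∑ y ∈ T \ S, Γ.w x y + ∑ x ∈ S, Γ.mu x := by
      rw [← Finset.mul_sum, Finset.sum_comm]
    _ ≤ p₀⁻¹ * ∑ x ∈ S, Γ.mu x + ∑ x ∈ S, Γ.mu x :=
      add_le_add_left (mul_le_mul_of_nonneg_left
        (Finset.sum_le_sum fun x _ => sum_w_le_mu x _) (inv_pos.2 hp.pos).le) _
    _ = (1 + p₀⁻¹) * ∑ x ∈ S, Γ.mu x := by ring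

lemma le_one [Nontrivial V] (hp : Γ.P0With p₀) : p₀ ≤ 1 := by
  obtain ⟨x⟩ := Γ.connected.nonempty
  obtain ⟨y, hxy⟩ := Γ.connected.preconnected.exists_adj_of_nontrivial x
  exact (mul_le_iff_le_one_left (mu_pos x)).1 ((hp.mul_mu_le hxy).trans (w_le_mu x y))

lemma pow_mul_mu_le [Nontrivial V] (hp : Γ.P0With p₀) {n : ℕ} {x y : V} (h : Γ.dist x y ≤ n) :
    p₀ ^ n * Γ.mu x ≤ Γ.mu y := by
  have hwalk {x y : V} (p : Γ.graph.Walk x y) : p₀ ^ p.length * Γ.mu x ≤ Γ.mu y := by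
    induction p with
    | nil => simp
    | @cons u v w huv p ih =>
      calc p₀ ^ (p.length + 1) * Γ.mu u = p₀ ^ p.length * (p₀ * Γ.mu u) := by ring
        _ ≤ p₀ ^ p.length * Γ.mu v := mul_le_mul_of_nonneg_left
          ((hp.mul_mu_le huv).trans ((Γ.w_symm u v).trans_le (w_le_mu v u)))
          (pow_pos hp.pos _).le
        _ ≤ Γ.mu w := ih
  obtain ⟨p, hlength⟩ := Γ.connected.exists_walk_length_eq_dist x y
  have hn : p.length ≤ n := by rw [hlength]; exact Nat.cast_le.1 h
  exact (mul_le_mul_of_nonneg_right (pow_le_pow_of_le_one hp.pos.le hp.le_one hn)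
    (mu_pos x).le).trans (hwalk p)

variable [Γ.graph.LocallyFinite]

lemma sum_mu_ballFinset_le (hp : Γ.P0With p₀) (x : V) (n : ℕ) :
    ∑ y ∈ Γ.ballFinset x (n + 1), Γ.mu y ≤ (1 + p₀⁻¹) ^ n * Γ.mu x := by
  induction n with
  | zero =>
    have : Γ.ballFinset x ((0 : ℕ) + 1) = {x} := by
      ext y
      rw [mem_ballFinset, Finset.mem_singleton, Nat.cast_zero, zero_add]
      exact ⟨fun h => (eq_of_dist_lt_one h).symm, by rintro rfl; rw [dist_self]; exact one_pos⟩
    rw [this, Finset.sum_singleton, pow_zero, one_mul]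
  | succ n ih =>
    rw [pow_succ', mul_assoc]
    refine (hp.sum_mu_le_of_subset_closure (S := Γ.ballFinset x (n + 1)) (fun y hy => ?_) ?_).trans
      (mul_le_mul_of_nonneg_left ih (add_pos one_pos (inv_pos.2 hp.pos)).le)
    · push_cast
      exact mem_ballFinset.2 ((mem_ballFinset.1 hy).trans (lt_add_one _))
    · push_cast [coe_ballFinset]
      exact ball_add_one_subset_closure_ball x (by positivity)

variable [Infinite V] {A : Set V} {e : V → ℝ} {M R : ℝ} {n : ℕ} {x : V}

lemma sq_sub_le_of_adj (hp : Γ.P0With p₀) (he : Γ.IsEquilibrium (Γ.ballFinset x R) A e M)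
    (hR : R ≤ n) {y z : V} (hyz : Γ.graph.Adj y z) :
    (e y - e z) ^ 2 ≤ 2 * M / (p₀ ^ (n + 1) * Γ.mu x) := by
  have hq : 0 < p₀ ^ (n + 1) * Γ.mu x := mul_pos (pow_pos hp.pos _) (mu_pos x)
  wlog hy : y ∈ Γ.ballFinset x R generalizing y z with hwlog
  · by_cases hz : z ∈ Γ.ballFinset x R
    · rw [← neg_sub, neg_sq]
      exact hwlog hyz.symm hz
    · rw [he.zero y hy, he.zero z hz, sub_self, zero_pow two_ne_zero]
      exact div_nonneg (mul_pos two_pos he.pos).le hq.le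
  obtain ⟨F, hF⟩ := exists_finset_closure_subset (Γ := Γ) (Γ.ballFinset x R)
  rw [le_div_iff₀' hq]
  calc p₀ ^ (n + 1) * Γ.mu x * (e y - e z) ^ 2 = p₀ * (p₀ ^ n * Γ.mu x) * (e y - e z) ^ 2 := by ring
    _ ≤ p₀ * Γ.mu y * (e y - e z) ^ 2 := by
      have := hp.pow_mul_mu_le ((mem_ballFinset.1 hy).le.trans hR)
      have := hp.pos
      gcongr
    _ ≤ Γ.w y z * (e y - e z) ^ 2 := mul_le_mul_of_nonneg_right (hp.mul_mu_le hyz) (sq_nonneg _)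
    _ ≤ 2 * Γ.form F e e :=
      w_mul_sq_le_two_mul_form (hF (subset_closure _ hy)) (hF (mem_closure_of_adj hy hyz)) e
    _ = 2 * M := by rw [he.form_self hF]

lemma equilibrium_value_le (hp : Γ.P0With p₀) (he : Γ.IsEquilibrium (Γ.ballFinset x R) A e M)
    (hR : R ≤ n) (hx : x ∈ A) : M ≤ 2 * n ^ 2 / p₀ ^ (n + 1) / Γ.mu x := by
  obtain ⟨z, hz⟩ := (finite_ball (Γ := Γ) x n).infinite_compl.nonempty
  obtain ⟨y, -, hy⟩ := exists_mem_segment_dist_eq (not_lt.1 (mt mem_ball.2 hz))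
  have hey : e y = 0 := he.zero y fun h => by linarith [mem_ballFinset.1 h]
  have hvalue := abs_sub_le_mul_dist (fun _ _ h => Real.abs_le_sqrt (hp.sq_sub_le_of_adj he hR h))
    x y
  rw [he.eq x hx, hey, sub_zero, abs_of_pos he.pos, hy] at hvalue
  have hsq : M ^ 2 ≤ 2 * M / (p₀ ^ (n + 1) * Γ.mu x) * n ^ 2 := by
    calc M ^ 2 ≤ (√(2 * M / (p₀ ^ (n + 1) * Γ.mu x)) * n) ^ 2 :=
          pow_le_pow_left₀ he.pos.le hvalue 2
      _ = _ := by
        rw [mul_pow, Real.sq_sqrt (div_nonneg (mul_pos two_pos he.pos).le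
          (mul_pos (pow_pos hp.pos _) (mu_pos x)).le)]
  refine le_of_mul_le_mul_left ?_ he.pos
  calc M * M = M ^ 2 := (sq M).symm
    _ ≤ 2 * M / (p₀ ^ (n + 1) * Γ.mu x) * n ^ 2 := hsq
    _ = M * (2 * n ^ 2 / p₀ ^ (n + 1) / Γ.mu x) := by rw [div_div]; ring

lemma ofReal_le_rho (hp : Γ.P0With p₀) {r : ℝ} (hr : r ≤ R) (hR : R ≤ n) :
    ENNReal.ofReal ((1 + p₀⁻¹) ^ n * Γ.mu x)⁻¹ ≤ Γ.rho x r R := by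
  obtain ⟨F, hF⟩ := exists_finset_closure_subset (Γ := Γ) (Γ.ballFinset x R)
  have hsub : Γ.ballFinset x r ⊆ Γ.ballFinset x R := fun y hy =>
    mem_ballFinset.2 ((mem_ballFinset.1 hy).trans_le hr)
  have hpos : 0 < (1 + p₀⁻¹) ^ n * Γ.mu x :=
    mul_pos (pow_pos (add_pos one_pos (inv_pos.2 hp.pos)) n) (mu_pos x)
  rw [rho_eq_resistance]
  refine ofReal_le_resistance (f := Set.indicator (Γ.ballFinset x r : Set V) 1) hF (fun y hy => ?_)
    (fun y hy => Set.indicator_of_notMem (mt (@hsub y) hy) 1) (inv_pos.2 hpos) ?_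
  · exact Set.indicator_of_mem (by rwa [coe_ballFinset]) 1
  · rw [inv_inv]
    calc _ ≤ ∑ y ∈ Γ.ballFinset x r, Γ.mu y :=
          form_indicator_one_le fun y hy => hF (subset_closure _ (hsub hy))
      _ ≤ ∑ y ∈ Γ.ballFinset x (n + 1), Γ.mu y :=
          Finset.sum_le_sum_of_subset_of_nonneg (fun y hy =>
            mem_ballFinset.2 (by linarith [mem_ballFinset.1 hy])) fun y _ _ => (mu_pos y).le
      _ ≤ _ := hp.sum_mu_ballFinset_le x n

lemma rho_le_mul_rho (hp : Γ.P0With p₀) (x : V) {r r' R' : ℝ} (hr : 0 < r) (hrR : r ≤ R)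
    (hR : R ≤ n) (hrR' : r' ≤ R') (hR' : R' ≤ n) :
    Γ.rho x r R ≤
      ENNReal.ofReal (2 * n ^ 2 / p₀ ^ (n + 1) * (1 + p₀⁻¹) ^ n) * Γ.rho x r' R' := by
  have hx := mem_ball_self (Γ := Γ) x hr
  obtain ⟨e, M, he⟩ := exists_isEquilibrium (Γ := Γ) (D := Γ.ballFinset x R) ⟨x, hx⟩
    (by rw [coe_ballFinset]; exact ball_subset_ball x hrR)
  have hC : 0 ≤ 2 * n ^ 2 / p₀ ^ (n + 1) * (1 + p₀⁻¹) ^ n := by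
    have := hp.pos
    positivity
  calc Γ.rho x r R = ENNReal.ofReal M := by rw [rho_eq_resistance, he.resistance_eq]
    _ ≤ ENNReal.ofReal (2 * n ^ 2 / p₀ ^ (n + 1) / Γ.mu x) :=
      ENNReal.ofReal_le_ofReal (hp.equilibrium_value_le he hR hx)
    _ = ENNReal.ofReal (2 * n ^ 2 / p₀ ^ (n + 1) * (1 + p₀⁻¹) ^ n) *
        ENNReal.ofReal ((1 + p₀⁻¹) ^ n * Γ.mu x)⁻¹ := by
      have hμ := (mu_pos (Γ := Γ) x).ne'
      have hinv : 1 + p₀⁻¹ ≠ 0 := (add_pos one_pos (inv_pos.2 hp.pos)).ne'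
      rw [← ENNReal.ofReal_mul hC]
      congr 1
      field_simp
    _ ≤ _ := mul_le_mul_right (hp.ofReal_le_rho hrR' hR') _

lemma exists_rho_le_mul_rho_of_large (hp : Γ.P0With p₀) {a b C : ℝ} (hab : a ≤ b) (hb : b ≤ 4)
    (h : ∀ x R, 32 ≤ R → Γ.rho x R (4 * R) ≤ ENNReal.ofReal C * Γ.rho x (a * R) (b * R)) :
    ∃ C' : ℝ≥0, 1 < C' ∧ ∀ x R, 0 ≤ R → Γ.rho x R (4 * R) ≤ C' * Γ.rho x (a * R) (b * R) := by
  obtain ⟨C₀, hC₀⟩ : ∃ C₀ : ℝ≥0, ∀ (x : V) (r R r' R' : ℝ), 0 < r → r ≤ R → R ≤ (128 : ℕ) →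
      r' ≤ R' → R' ≤ (128 : ℕ) → Γ.rho x r R ≤ C₀ * Γ.rho x r' R' :=
    ⟨_, fun x _ _ _ _ => hp.rho_le_mul_rho x⟩
  have hone : 1 < max 2 (max C.toNNReal C₀) := one_lt_two.trans_le (le_max_left _ _)
  refine ⟨max 2 (max C.toNNReal C₀), hone, fun x R hR => ?_⟩
  rcases hR.eq_or_lt with rfl | hpos
  · simp only [mul_zero]
    exact le_mul_of_one_le_left zero_le (by exact_mod_cast hone.le)
  rcases le_or_gt 32 R with hlarge | hsmall
  · refine (h x R hlarge).trans (mul_le_mul_left (ENNReal.coe_le_coe.2 ?_) _)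
    exact (le_max_left _ _).trans (le_max_right _ _)
  · refine (hC₀ x R (4 * R) (a * R) (b * R) hpos (by linarith) (by norm_num; linarith)
      (by gcongr) (by norm_num; nlinarith)).trans (mul_le_mul_left (ENNReal.coe_le_coe.2 ?_) _)
    exact (le_max_right _ _).trans (le_max_right _ _)

end P0With

end BoundedSize

end WeightedGraph

theorem mainTheorem3 {V : Type*} [Countable V] [Infinite V] (Γ : WeightedGraph V)
    (hp : Γ.P0) (hH : Γ.Harnack) :
    (∃ C₂ : ℝ≥0, 1 < C₂ ∧ ∀ (x : V) (R : ℝ), 0 ≤ R →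
      Γ.rho x R (4 * R) ≤ C₂ * Γ.rho x (2 * R) (4 * R)) ∧
    (Γ.BoundedCovering →
      ∃ C₁ : ℝ≥0, 1 < C₁ ∧ ∀ (x : V) (R : ℝ), 0 ≤ R →
        Γ.rho x R (4 * R) ≤ C₁ * Γ.rho x R (2 * R)) := by
  obtain ⟨p₀, hp⟩ := hp.exists_p0With
  let _ : Γ.graph.LocallyFinite := fun x => (hp.finite_neighborSet x).fintype
  obtain ⟨H, hH⟩ := hH.exists_harnackWith
  refine ⟨hp.exists_rho_le_mul_rho_of_large (by norm_num) le_rfl fun x R hR =>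
    hH.rho_le_mul_rho_two_mul x hR, fun hBC => ?_⟩
  obtain ⟨C, hC⟩ := hH.exists_rho_le_mul_rho_of_boundedCovering hBC
  have hlarge (x : V) (R : ℝ) (hR : 32 ≤ R) :
      Γ.rho x R (4 * R) ≤ ENNReal.ofReal C * Γ.rho x (1 * R) (2 * R) := by
    rw [one_mul]
    exact hC x R hR
  simpa only [one_mul] using hp.exists_rho_le_mul_rho_of_large one_le_two (by norm_num) hlarge
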